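/- Let $q_0>0$ and $T,\alpha,\theta_+,\theta_-\in\mathbb R$, and put $\phi(x,t)=\alpha x+2\left(-q_0^2+2T^2q_0^4-\tfrac{\alpha^2}{2}\right)t$, $u_\pm(x,t)=q_0e^{i(\phi(x,t)+\theta_\pm)}$, $q_\pm=q_0e^{i\theta_\pm}$. Let $u(x,t)$ be complex-valued and $t\in\mathbb R$ a time such that $u(\cdot,t)$ is continuous, $u(x,t)-u_\pm(x,t)\to0$ as $x\to\pm\infty$, and $u(\cdot,t)-u_\pm(\cdot,t)\in L^1(\mathbb R^\pm)$. In particular, $u$ may be a solution of the defocusing Kundu–Eckhaus equation $iu_t+u_{xx}-2|u|^2u+4T^2|u|^4u+4iT(|u|^2)_xu=0$ with the nonzero boundary conditions $u\to u_\pm$, $u-u_\pm\in L^{1,2}(\mathbb R^\pm)$, and $t$ any time. Put $q=ue^{-i\phi}$. For $\zeta\in\mathbb C\setminus\{0\}$ let $\kappa=\tfrac12(\zeta+q_0^2\zeta^{-1})$, $\lambda=\tfrac12(\zeta-q_0^2\zeta^{-1})$, $z=\kappa-Tq_0^2-\tfrac{\alpha}{2}$, $\Theta(x,t,\zeta)=\lambda\left(x+2\left(z-Tq_0^2-\tfrac{\alpha}{2}\right)t\right)$,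 and consider the scattering problem $$\psi_x=X\psi,\qquad X=\begin{pmatrix}0&q\\ \bar q&0\end{pmatrix}-i\left(z+T|q|^2+\tfrac{\alpha}{2}\right)\begin{pmatrix}1&0\\0&-1\end{pmatrix}.$$ Let $D=\{\zeta:\operatorname{Im}\zeta\ge0\}\setminus\{0,q_0,-q_0\}$. Then for every $\zeta\in D$: * There are a unique solution $\psi_{-1}$ with $e^{i\Theta}\psi_{-1}\to(1,\,i\bar q_-\zeta^{-1})^{\mathsf T}$ as $x\to-\infty$, and a unique solution $\psi_{+2}=(\psi_{+12},\psi_{+22})^{\mathsf T}$ with $e^{-i\Theta}\psi_{+2}\to(-iq_+\zeta^{-1},\,1)^{\mathsf T}$ as $x\to+\infty$ (the Jost solutions). * Their Wronskian $W[\psi_{-1},\psi_{+2}]=\det(\psi_{-1},\psi_{+2})$ does not depend on $x$. The scattering coefficient is $a(\zeta)=W[\psi_{-1},\psi_{+2}]/(1-q_0^2\zeta^{-2})$. Moreover $a$ is analytic in $\{\operatorname{Im}\zeta>0\}$, and it has only simple zeros, located on the open upper semicircle: if $\zeta_j\in D$ and $a(\zeta_j)=0$, then $\operatorname{Im}\zeta_j>0$,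 $|\zeta_j|=q_0$, and there is a constant $b_j\in\mathbb C$, independent of $x$, such that $\psi_{-1}(x,t,\zeta_j)=b_j\psi_{+2}(x,t,\zeta_j)$ for all $x$, the function $|\psi_{+22}(\cdot,t,\zeta_j)|^2$ is integrable on $\mathbb R$, and $$\dot a(\zeta_j)=-\,b_j\,q_+\,\zeta_j^{-1}\int_{-\infty}^{\infty}|\psi_{+22}(x,t,\zeta_j)|^2\,dx\neq0 .$$ -/

import Mathlib

open Filter Topology MeasureTheory Complex Matrix

namespace KE

/-- The real constants of the problem: the background amplitude `q₀ > 0`, the constant `T` of the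
Kundu-Eckhaus equation, the wave number `α` and the asymptotic phases `θ₊`, `θ₋`. -/
structure Params where
  q₀ : ℝ
  T : ℝ
  α : ℝ
  θp : ℝ
  θm : ℝ
  q₀_pos : 0 < q₀

variable (p : Params)

/-- The phase `α x + 2 (-q₀² + 2 T² q₀⁴ - α² / 2) t` of the background plane wave. -/
noncomputable def phase (x t : ℝ) : ℝ :=
  p.α * x + 2 * (-p.q₀ ^ 2 + 2 * p.T ^ 2 * p.q₀ ^ 4 - p.α ^ 2 / 2) * t

/-- The background plane wave with amplitude `q₀` and additional phase `θ`;
`u₊` and `u₋` are the cases `θ = θ₊` and `θ = θ₋`. -/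
noncomputable def planeWave (θ x t : ℝ) : ℂ :=
  p.q₀ * exp (I * ((phase p x t + θ : ℝ) : ℂ))

/-- The constant `q₀ e^{iθ}`; `q₊` and `q₋` are the cases `θ = θ₊` and `θ = θ₋`. -/
noncomputable def qInf (θ : ℝ) : ℂ := p.q₀ * exp (I * θ)

/-- The nonzero boundary conditions on `u` at time `t`: the profile `u(·, t)` is continuous,
`u - u₊` and `u - u₋` vanish at `+∞` and `-∞`, and are integrable on the half lines there. For a solution `u` of the Kundu-Eckhaus equation with
these boundary conditions this holds at every time; the scattering problem at time `t` depends on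
`u` only through the profile `u(·, t)`. -/
structure NonzeroBoundary (u : ℝ → ℝ → ℂ) (t : ℝ) : Prop where
  continuous : Continuous fun x => u x t
  tendsto_top : Tendsto (fun x => u x t - planeWave p p.θp x t) atTop (𝓝 0)
  tendsto_bot : Tendsto (fun x => u x t - planeWave p p.θm x t) atBot (𝓝 0)
  integrable_top : IntegrableOn (fun x => u x t - planeWave p p.θp x t) (Set.Ici 0)
  integrable_bot : IntegrableOn (fun x => u x t - planeWave p p.θm x t) (Set.Iic 0)

/-- The potential `q` obtained from `u` by removing the phase of the background. -/
noncomputable def potential (u : ℝ → ℝ → ℂ) (x t : ℝ) : ℂ :=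
  u x t * exp (-(I * (phase p x t : ℂ)))

/-- `κ = (ζ + q₀² / ζ) / 2`. -/
noncomputable def kappa (ζ : ℂ) : ℂ := (ζ + p.q₀ ^ 2 * ζ⁻¹) / 2

/-- `lam = (ζ - q₀² / ζ) / 2`. -/
noncomputable def lam (ζ : ℂ) : ℂ := (ζ - p.q₀ ^ 2 * ζ⁻¹) / 2

/-- The spectral parameter `z = κ - T q₀² - α / 2` as a function of the uniformization
variable `ζ`. -/
noncomputable def specZ (ζ : ℂ) : ℂ := kappa p ζ - p.T * p.q₀ ^ 2 - p.α / 2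

/-- `Θ(x, t, ζ) = lam (x + 2 (z - T q₀² - α / 2) t)`. -/
noncomputable def Theta (x t : ℝ) (ζ : ℂ) : ℂ :=
  lam p ζ * (x + 2 * (specZ p ζ - p.T * p.q₀ ^ 2 - p.α / 2) * t)

/-- The coefficient matrix `X = Q - i (z + T |q|² + α / 2) σ₃` of the `x`-part of the Lax pair,
where `Q` has the off-diagonal entries `q` and `conj q`. -/
noncomputable def laxX (u : ℝ → ℝ → ℂ) (x t : ℝ) (ζ : ℂ) : Matrix (Fin 2) (Fin 2) ℂ :=
  !![0, potential p u x t; (starRingEnd ℂ) (potential p u x t), 0]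
    - (I * (specZ p ζ + p.T * (‖potential p u x t‖ : ℂ) ^ 2 + p.α / 2)) •
      !![(1 : ℂ), 0; 0, -1]

/-- The matrix `E₊` (for `θ = θ₊`) or `E₋` (for `θ = θ₋`) of asymptotic eigenvectors. -/
noncomputable def eigMatrix (θ : ℝ) (ζ : ℂ) : Matrix (Fin 2) (Fin 2) ℂ :=
  !![1, -I * qInf p θ * ζ⁻¹; I * (starRingEnd ℂ) (qInf p θ) * ζ⁻¹, 1]

/-- `f` is the first column of the Jost solution `ψ₋`: it solves the scattering problem
`f' = X f` at time `t` and `f e^{iΘ}` tends to the first column of `E₋` as `x → -∞`. -/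
def IsJostMinusOne (u : ℝ → ℝ → ℂ) (t : ℝ) (ζ : ℂ) (f : ℝ → Fin 2 → ℂ) : Prop :=
  (∀ x, HasDerivAt f (laxX p u x t ζ *ᵥ f x) x) ∧
    Tendsto (fun x => exp (I * Theta p x t ζ) • f x) atBot
      (𝓝 fun i => eigMatrix p p.θm ζ i 0)

/-- `f` is the second column of the Jost solution `ψ₊`: it solves the scattering problem
`f' = X f` at time `t` and `f e^{-iΘ}` tends to the second column of `E₊` as `x → +∞`. -/
def IsJostPlusTwo (u : ℝ → ℝ → ℂ) (t : ℝ) (ζ : ℂ) (f : ℝ → Fin 2 → ℂ) : Prop :=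
  (∀ x, HasDerivAt f (laxX p u x t ζ *ᵥ f x) x) ∧
    Tendsto (fun x => exp (-(I * Theta p x t ζ)) • f x) atTop
      (𝓝 fun i => eigMatrix p p.θp ζ i 1)

/-- The Jost solution `ψ₋₁(·, t, ζ)`. -/
noncomputable def psiMinusOne (u : ℝ → ℝ → ℂ) (t : ℝ) (ζ : ℂ) : ℝ → Fin 2 → ℂ :=
  Classical.epsilon (IsJostMinusOne p u t ζ)

/-- The Jost solution `ψ₊₂(·, t, ζ)`. -/
noncomputable def psiPlusTwo (u : ℝ → ℝ → ℂ) (t : ℝ) (ζ : ℂ) : ℝ → Fin 2 → ℂ :=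
  Classical.epsilon (IsJostPlusTwo p u t ζ)

/-- The Wronskian `W[f, g] = f₁ g₂ - g₁ f₂`. -/
def wronskian (f g : Fin 2 → ℂ) : ℂ := f 0 * g 1 - g 0 * f 1

/-- The scattering coefficient `a(ζ) = W[ψ₋₁, ψ₊₂] / (1 - q₀² / ζ²)`, evaluated at `x = 0` (the
Wronskian does not depend on `x`). Since `W[ψ₊₁, ψ₊₂] = det E₊ = 1 - q₀² / ζ²`, it is for real `ζ`
the coefficient `a` in `ψ₋₁ = a ψ₊₁ + b ψ₊₂`, that is, the first diagonal entry of the scattering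
matrix `s` in `ψ₋ = ψ₊ s`; the Wronskian formula extends it to the upper half plane. -/
noncomputable def scatA (u : ℝ → ℝ → ℂ) (t : ℝ) (ζ : ℂ) : ℂ :=
  wronskian (psiMinusOne p u t ζ 0) (psiPlusTwo p u t ζ 0) / (1 - p.q₀ ^ 2 * (ζ ^ 2)⁻¹)

/-- The domain of `a`: the closed upper half plane without `0` and the branch points `±q₀`. -/
def scatDomain : Set ℂ := {ζ | 0 ≤ ζ.im ∧ ζ ≠ 0 ∧ ζ ≠ p.q₀ ∧ ζ ≠ -p.q₀}

end KE

namespace KE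

open Set

/-! ### Volterra equations on half lines reaching to -∞ -/

section Volterra

variable {E : Type*} [NormedAddCommGroup E] [NormedSpace ℂ E]

/-! In terms of κ, the scattering problem is the defocusing Zakharov-Shabat system for `q` whose
spectral parameter κ is shifted by the real function T(|q|² - q₀²) (`laxX_eq`). This shift is
integrable towards each end, so the system is an integrable perturbation of a constant one. The
limiting matrix has eigenvalues ±iλ; multiplication by e^{iλx} moves them to 0 and 2iλ, with Re 2iλ
≤ 0 in the closed upper half plane. Hence the Jost solution at -∞ solves a Volterra equation with
bounded propagator. In a sup norm with an exponential weight the integral operator has norm at most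
1/2, which gives existence, uniqueness, holomorphy in ζ and exponential decay at once. The
reflection x ↦ -x with exchange of components turns ψ₊₂ into a solution of the same kind, so one end
is enough.

A zero of `a` makes ψ₋₁ and ψ₊₂ proportional. For real ζ the quantity |f₀|² - |f₁|² is conserved and
the two ends give it opposite signs, so 1 - q₀²/|ζ|² = 0, which the domain excludes
(`im_pos_of_scatA_eq_zero`). For Im ζ > 0 the common solution decays at both ends, and
self-adjointness makes κ real (`IsZS.im_eq_zero`); off the real axis this means |ζ| = q₀.

For the derivative, the Wronskian of solutions at two spectral parameters has x-derivative
proportional to κ' - κ. Integrating from the end where both decay and letting ζ' → ζ yields the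
Wronskian of ∂_ζψ with ψ (`IsTail.wronskian_deriv`). The two half lines add up to ∫ψ₊₁₂ψ₊₂₂, and on
the circle conjugation symmetry turns the product into a constant times |ψ₊₂₂|² (`psiPlusTwo_symm`).
So the derivative is a nonzero multiple of a positive integral, and the zero is simple. -/

lemma integrableOn_Iic_of_continuous {F : Type*} [NormedAddCommGroup F] {f : ℝ → F}
    (hf : Continuous f) {a : ℝ} (h : IntegrableOn f (Iic a)) (x : ℝ) : IntegrableOn f (Iic x) := by
  refine (h.union (hf.integrableOn_Icc (a := a) (b := x))).mono_set fun y hy => ?_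
  rcases le_total y a with hya | hya
  · exact Or.inl hya
  · exact Or.inr ⟨hya, hy⟩

lemma hasDerivAt_integral_Iic {F : Type*} [NormedAddCommGroup F] [NormedSpace ℝ F]
    [CompleteSpace F] {f : ℝ → F} (hf : Continuous f) (hi : ∀ x, IntegrableOn f (Iic x)) (x : ℝ) :
    HasDerivAt (fun x => ∫ y in Iic x, f y) (f x) x := by
  have h : (fun x => ∫ y in Iic x, f y) = fun x => (∫ y in Iic 0, f y) + ∫ y in (0 : ℝ)..x, f y := by
    funext x
    rw [← intervalIntegral.integral_Iic_sub_Iic (hi 0) (hi x)]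
    abel
  rw [h]
  exact (intervalIntegral.integral_hasDerivAt_right (hf.intervalIntegrable _ _)
    hf.stronglyMeasurable.stronglyMeasurableAtFilter hf.continuousAt).const_add _

/-- The exponential weight `exp (2 ∫_{-∞}^x m)`, for which Volterra operators with kernel bounded
by `m` are contractions. -/
noncomputable def volterraWeight (m : ℝ → ℝ) (x : ℝ) : ℝ := Real.exp (2 * ∫ y in Iic x, m y)

lemma one_le_volterraWeight {m : ℝ → ℝ} (hm : ∀ y, 0 ≤ m y) (x : ℝ) : 1 ≤ volterraWeight m x :=
  Real.one_le_exp (mul_nonneg (by norm_num) (setIntegral_nonneg measurableSet_Iic fun y _ => hm y))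

section Weight

variable {m : ℝ → ℝ} (hmc : Continuous m) (hmi : ∀ x, IntegrableOn m (Iic x))

lemma volterraWeight_pos (m : ℝ → ℝ) (x : ℝ) : 0 < volterraWeight m x := Real.exp_pos _

include hmc hmi in
lemma hasDerivAt_volterraWeight (x : ℝ) :
    HasDerivAt (volterraWeight m) (2 * (m x * volterraWeight m x)) x := by
  have := ((hasDerivAt_integral_Iic hmc hmi x).const_mul 2).exp
  exact this.congr_deriv (by rw [volterraWeight]; ring)

include hmc hmi in
lemma continuous_volterraWeight : Continuous (volterraWeight m) :=
  continuous_iff_continuousAt.2 fun x => (hasDerivAt_volterraWeight hmc hmi x).continuousAt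

lemma tendsto_volterraWeight_atBot (m : ℝ → ℝ) : Tendsto (volterraWeight m) atBot (𝓝 1) := by
  have h : Tendsto (fun x : ℝ => ∫ y in Iic x, m y) atBot (𝓝 0) :=
    tendsto_integral_Iic_zero tendsto_id
  have := (Real.continuous_exp.tendsto _).comp (h.const_mul 2)
  rw [mul_zero, Real.exp_zero] at this
  exact this

include hmi in
lemma volterraWeight_mono (hm0 : ∀ x, 0 ≤ m x) : Monotone (volterraWeight m) := fun x y hxy =>
  Real.exp_le_exp.2 <| mul_le_mul_of_nonneg_left
    (setIntegral_mono_set (hmi y) (ae_of_all _ hm0) (Iic_subset_Iic.2 hxy).eventuallyLE) (by norm_num)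

include hmc hmi in
lemma integrableOn_mul_volterraWeight (hm0 : ∀ x, 0 ≤ m x) (x : ℝ) :
    IntegrableOn (fun y => m y * volterraWeight m y) (Iic x) := by
  refine Integrable.mono' ((hmi x).mul_const (volterraWeight m x))
    (hmc.mul (continuous_volterraWeight hmc hmi)).aestronglyMeasurable ?_
  filter_upwards [ae_restrict_mem measurableSet_Iic] with y hy
  rw [Real.norm_of_nonneg (mul_nonneg (hm0 y) (volterraWeight_pos m y).le)]
  exact mul_le_mul_of_nonneg_left (volterraWeight_mono hmi hm0 hy) (hm0 y)

include hmc hmi in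
-- The weight w satisfies w' = 2mw and w(-∞) = 1. The factor 2 in its exponent is the source of the
-- contraction constant 1/2.
lemma integral_mul_volterraWeight (hm0 : ∀ x, 0 ≤ m x) (x : ℝ) :
    ∫ y in Iic x, m y * volterraWeight m y = (volterraWeight m x - 1) / 2 := by
  have := integral_Iic_of_hasDerivAt_of_tendsto' (a := x)
    (fun y _ => hasDerivAt_volterraWeight hmc hmi y)
    ((integrableOn_mul_volterraWeight hmc hmi hm0 x).const_mul 2) (tendsto_volterraWeight_atBot m)
  rw [integral_const_mul] at this
  linarith

end Weight

/-- The kernel `(1 - P) + e^{μ r} P`, the exponential of `r μ P` for a projection `P`. -/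
noncomputable def projKernel (P : E →L[ℂ] E) (μ : ℂ) (r : ℝ) : E →L[ℂ] E :=
  (1 - P) + exp (μ * r) • P

/-- The Volterra operator with kernel `projKernel P μ (x - y) ∘ D y`. -/
noncomputable def volterraOp (P : E →L[ℂ] E) (μ : ℂ) (D : ℝ → E →L[ℂ] E) (h : ℝ → E) (x : ℝ) : E :=
  ∫ y in Iic x, projKernel P μ (x - y) (D y (h y))

/-- The terms of the Neumann series of the Volterra equation `h = e + volterraOp P μ D h`. -/
noncomputable def neumannTerm (P : E →L[ℂ] E) (μ : ℂ) (D : ℝ → E →L[ℂ] E) (e : E) : ℕ → ℝ → E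
  | 0 => fun _ => e
  | n + 1 => volterraOp P μ D (neumannTerm P μ D e n)

lemma norm_projKernel_le (P : E →L[ℂ] E) {μ : ℂ} (hμ : μ.re ≤ 0) {r : ℝ} (hr : 0 ≤ r) :
    ‖projKernel P μ r‖ ≤ ‖1 - P‖ + ‖P‖ := by
  refine (norm_add_le _ _).trans (add_le_add_right ?_ _)
  rw [norm_smul, Complex.norm_exp]
  have : (μ * r).re ≤ 0 := by
    simp only [mul_re, ofReal_re, ofReal_im, mul_zero, sub_zero]
    exact mul_nonpos_of_nonpos_of_nonneg hμ hr
  exact mul_le_of_le_one_left (norm_nonneg _) (Real.exp_le_one_iff.2 this)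

lemma continuous_projKernel (P : E →L[ℂ] E) (μ : ℂ) : Continuous (projKernel P μ) := by
  unfold projKernel; fun_prop

/-- The data of a Volterra equation on the whole line: the kernel is continuous and bounded by a
function `m` which is integrable at `-∞`. -/
structure IsVolterra (P : E →L[ℂ] E) (μ : ℂ) (D : ℝ → E →L[ℂ] E) (m : ℝ → ℝ) : Prop where
  re_nonpos : μ.re ≤ 0
  contD : Continuous D
  contm : Continuous m
  intm : ∀ x, IntegrableOn m (Iic x)
  bound : ∀ y, (‖1 - P‖ + ‖P‖) * ‖D y‖ ≤ m y

namespace IsVolterra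

variable {P : E →L[ℂ] E} {μ : ℂ} {D : ℝ → E →L[ℂ] E} {m : ℝ → ℝ} (V : IsVolterra P μ D m)

include V

lemma m_nonneg (y : ℝ) : 0 ≤ m y :=
  (by positivity : 0 ≤ (‖1 - P‖ + ‖P‖) * ‖D y‖).trans (V.bound y)

lemma norm_integrand_le {h : E} {x y w : ℝ} (hy : y ≤ x) (hh : ‖h‖ ≤ w) :
    ‖projKernel P μ (x - y) (D y h)‖ ≤ m y * w := by
  have h1 := norm_projKernel_le P V.re_nonpos (sub_nonneg.2 hy)
  calc ‖projKernel P μ (x - y) (D y h)‖ ≤ ‖projKernel P μ (x - y)‖ * (‖D y‖ * ‖h‖) :=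
        (ContinuousLinearMap.le_opNorm _ _).trans
          (mul_le_mul_of_nonneg_left (ContinuousLinearMap.le_opNorm _ _) (norm_nonneg _))
    _ ≤ ((‖1 - P‖ + ‖P‖) * ‖D y‖) * ‖h‖ := by
        rw [← mul_assoc]; gcongr
    _ ≤ m y * w := mul_le_mul (V.bound y) hh (norm_nonneg _) (V.m_nonneg y)

lemma continuous_integrand {h : ℝ → E} (hc : Continuous h) (x : ℝ) :
    Continuous fun y => projKernel P μ (x - y) (D y (h y)) := by
  have h1 : Continuous fun y : ℝ => projKernel P μ (x - y) :=
    (continuous_projKernel P μ).comp (by fun_prop)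
  exact h1.clm_apply (V.contD.clm_apply hc)

lemma integrableOn_mul_weight (c x : ℝ) :
    IntegrableOn (fun y => m y * (c * volterraWeight m y)) (Iic x) := by
  have := (integrableOn_mul_volterraWeight V.contm V.intm V.m_nonneg x).const_mul c
  refine this.congr (ae_of_all _ fun y => ?_)
  simp only; ring

lemma integral_mul_weight (c x : ℝ) :
    ∫ y in Iic x, m y * (c * volterraWeight m y) = c * ((volterraWeight m x - 1) / 2) := by
  rw [← integral_mul_volterraWeight V.contm V.intm V.m_nonneg x, ← integral_const_mul]
  congr 1; funext y; ring

lemma integrableOn_integrand {h : ℝ → E} (hc : Continuous h) {c x : ℝ}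
    (hh : ∀ y ≤ x, ‖h y‖ ≤ c * volterraWeight m y) :
    IntegrableOn (fun y => projKernel P μ (x - y) (D y (h y))) (Iic x) := by
  refine Integrable.mono' (V.integrableOn_mul_weight c x)
    (V.continuous_integrand hc x).aestronglyMeasurable ?_
  filter_upwards [ae_restrict_mem measurableSet_Iic] with y hy
  exact V.norm_integrand_le hy (hh y hy)

/-- Keeping the -1 from the integral of the weight makes the bound vanish at -∞, which later gives
the limit of the solution there. -/
lemma norm_volterraOp_le_sub {h : ℝ → E} {c x : ℝ}
    (hh : ∀ y ≤ x, ‖h y‖ ≤ c * volterraWeight m y) :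
    ‖volterraOp P μ D h x‖ ≤ c * ((volterraWeight m x - 1) / 2) := by
  rw [← V.integral_mul_weight]
  refine norm_integral_le_of_norm_le (V.integrableOn_mul_weight c x) ?_
  filter_upwards [ae_restrict_mem measurableSet_Iic] with y hy
  exact V.norm_integrand_le hy (hh y hy)

lemma norm_volterraOp_le {h : ℝ → E} {c x : ℝ} (hc : 0 ≤ c)
    (hh : ∀ y ≤ x, ‖h y‖ ≤ c * volterraWeight m y) :
    ‖volterraOp P μ D h x‖ ≤ c / 2 * volterraWeight m x := by
  have := V.norm_volterraOp_le_sub hh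
  linarith

/-- Each substitution of the equation into itself halves the weighted bound. Values at y ≤ X involve
only points below X, so boundedness on left half lines suffices. -/
lemma eq_zero_of_eq_volterraOp {h : ℝ → E} (hb : ∀ x, ∃ C, ∀ y ≤ x, ‖h y‖ ≤ C)
    (he : ∀ x, h x = volterraOp P μ D h x) : h = 0 := by
  funext X
  obtain ⟨C, hC⟩ := hb X
  have hC0 : 0 ≤ C := (norm_nonneg _).trans (hC X le_rfl)
  have key : ∀ n : ℕ, ∀ y ≤ X, ‖h y‖ ≤ C * (1 / 2) ^ n * volterraWeight m y := by
    intro n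
    induction n with
    | zero =>
      intro y hy
      have h1 := one_le_volterraWeight V.m_nonneg y
      simpa using (hC y hy).trans (le_mul_of_one_le_right hC0 h1)
    | succ n ih =>
      intro y hy
      rw [he y]
      have := V.norm_volterraOp_le (h := h) (c := C * (1 / 2) ^ n) (x := y) (by positivity)
        fun z hz => ih z (hz.trans hy)
      rw [pow_succ]; linarith
  have hlim : Tendsto (fun n : ℕ => C * (1 / 2 : ℝ) ^ n * volterraWeight m X) atTop (𝓝 0) := by
    have := ((tendsto_pow_atTop_nhds_zero_of_lt_one (r := (1 / 2 : ℝ)) (by norm_num)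
      (by norm_num)).const_mul C).mul_const (volterraWeight m X)
    simpa using this
  have : ‖h X‖ ≤ 0 := ge_of_tendsto' hlim fun n => key n X le_rfl
  simpa using this

variable [CompleteSpace E]

lemma hasDerivAt_volterraOp (hP : P * P = P) {h : ℝ → E} (hc : Continuous h) {c : ℝ}
    (hh : ∀ y, ‖h y‖ ≤ c * volterraWeight m y) (x : ℝ) :
    HasDerivAt (volterraOp P μ D h) (μ • P (volterraOp P μ D h x) + D x (h x)) x := by
  have hPP : ∀ v, P (P v) = P v := fun v => by
    have := congrArg (fun A : E →L[ℂ] E => A v) hP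
    simpa using this
  have hDc : Continuous fun y => D y (h y) := V.contD.clm_apply hc
  have hDi : ∀ x, IntegrableOn (fun y => (1 - P) (D y (h y))) (Iic x) := by
    intro x
    refine Integrable.mono' (V.integrableOn_mul_weight c x)
      ((1 - P).continuous.comp hDc).aestronglyMeasurable (ae_of_all _ fun y => ?_)
    calc ‖(1 - P) (D y (h y))‖ ≤ ‖1 - P‖ * (‖D y‖ * ‖h y‖) :=
        (ContinuousLinearMap.le_opNorm _ _).trans
          (mul_le_mul_of_nonneg_left (ContinuousLinearMap.le_opNorm _ _) (norm_nonneg _))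
      _ ≤ ((‖1 - P‖ + ‖P‖) * ‖D y‖) * ‖h y‖ := by
        rw [← mul_assoc]; gcongr; linarith [norm_nonneg P]
      _ ≤ _ := mul_le_mul (V.bound y) (hh y) (norm_nonneg _) (V.m_nonneg y)
  have hEc : Continuous fun y : ℝ => exp (-(μ * y)) • P (D y (h y)) :=
    (by fun_prop : Continuous fun y : ℝ => exp (-(μ * y))).smul (P.continuous.comp hDc)
  have hEi : ∀ x, IntegrableOn (fun y : ℝ => exp (-(μ * y)) • P (D y (h y))) (Iic x) := by
    intro x
    refine Integrable.mono' ((V.integrableOn_mul_weight c x).const_mul (Real.exp (-(μ.re * x))))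
      hEc.aestronglyMeasurable ?_
    filter_upwards [ae_restrict_mem measurableSet_Iic] with y hy
    rw [norm_smul, Complex.norm_exp]
    -- Since Re μ ≤ 0, |e^{-μy}| is largest at the right end y = x, so this factor does no harm at
    -- -∞.
    have h1 : (-(μ * y)).re ≤ -(μ.re * x) := by
      simp only [neg_re, mul_re, ofReal_re, ofReal_im, mul_zero, sub_zero]
      linarith [mul_le_mul_of_nonpos_left (mem_Iic.1 hy) V.re_nonpos]
    refine mul_le_mul (Real.exp_le_exp.2 h1) ?_ (norm_nonneg _) (Real.exp_pos _).le
    calc ‖P (D y (h y))‖ ≤ ‖P‖ * (‖D y‖ * ‖h y‖) :=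
        (ContinuousLinearMap.le_opNorm _ _).trans
          (mul_le_mul_of_nonneg_left (ContinuousLinearMap.le_opNorm _ _) (norm_nonneg _))
      _ ≤ ((‖1 - P‖ + ‖P‖) * ‖D y‖) * ‖h y‖ := by
        rw [← mul_assoc]; gcongr; linarith [norm_nonneg (1 - P)]
      _ ≤ _ := mul_le_mul (V.bound y) (hh y) (norm_nonneg _) (V.m_nonneg y)
  -- Splitting e^{μ(x-y)} into e^{μx}e^{-μy} removes x from the integrands, so only the fundamental
  -- theorem of calculus and the product rule are needed.
  have hform : volterraOp P μ D h = fun x : ℝ => (∫ y in Iic x, (1 - P) (D y (h y))) +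
      exp (μ * x) • ∫ y in Iic x, exp (-(μ * y)) • P (D y (h y)) := by
    funext x
    rw [← integral_smul, ← integral_add (hDi x) (by exact (hEi x).smul (exp (μ * x)))]
    refine integral_congr_ae (ae_of_all _ fun y => ?_)
    simp only [projKernel, _root_.add_apply, _root_.smul_apply, smul_smul,
      ← Complex.exp_add]
    congr 3
    push_cast; ring
  have hPE : P (∫ y in Iic x, exp (-(μ * y)) • P (D y (h y))) =
      ∫ y in Iic x, exp (-(μ * y)) • P (D y (h y)) := by
    rw [← P.integral_comp_comm (hEi x)]
    simp only [map_smul, hPP]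
  have hPD : P (∫ y in Iic x, (1 - P) (D y (h y))) = 0 := by
    rw [← P.integral_comp_comm (hDi x)]
    simp [hPP]
  have hexp : HasDerivAt (fun x : ℝ => exp (μ * x)) (μ * exp (μ * x)) x := by
    have := ((hasDerivAt_id (x : ℂ)).const_mul μ).cexp.comp_ofReal
    simpa [mul_comm] using this
  rw [hform]
  refine ((hasDerivAt_integral_Iic ((1 - P).continuous.comp hDc) hDi x).add
    (hexp.smul (hasDerivAt_integral_Iic hEc hEi x))).congr_deriv ?_
  simp only [map_add, map_smul, hPE, hPD, zero_add, Function.comp_apply, smul_smul,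
    ← Complex.exp_add]
  simp
  abel

omit [CompleteSpace E] in
lemma norm_neumannTerm_le {e : E} {c : ℝ} (he : ‖e‖ ≤ c) (n : ℕ) (x : ℝ) :
    ‖neumannTerm P μ D e n x‖ ≤ c * (1 / 2) ^ n * volterraWeight m x := by
  have hc : 0 ≤ c := (norm_nonneg _).trans he
  induction n generalizing x with
  | zero =>
    have h1 := one_le_volterraWeight V.m_nonneg x
    simpa [neumannTerm] using he.trans (le_mul_of_one_le_right hc h1)
  | succ n ih =>
    have := V.norm_volterraOp_le (h := neumannTerm P μ D e n) (c := c * (1 / 2) ^ n) (x := x)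
      (by positivity) fun z _ => ih z
    rw [pow_succ]
    simp only [neumannTerm]; linarith

lemma continuous_neumannTerm (hP : P * P = P) (e : E) (n : ℕ) :
    Continuous (neumannTerm P μ D e n) := by
  induction n with
  | zero => exact continuous_const
  | succ n ih =>
    exact continuous_iff_continuousAt.2 fun x =>
      (V.hasDerivAt_volterraOp hP ih (V.norm_neumannTerm_le le_rfl n) x).continuousAt

lemma summable_neumannTerm (e : E) (x : ℝ) : Summable fun n => neumannTerm P μ D e n x := by
  refine Summable.of_norm_bounded (g := fun n => ‖e‖ * (1 / 2) ^ n * volterraWeight m x) ?_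
    fun n => V.norm_neumannTerm_le le_rfl n x
  exact ((summable_geometric_of_lt_one (by norm_num) (by norm_num)).mul_left _).mul_right _

omit [CompleteSpace E] in
lemma norm_tsum_neumannTerm_le {e : E} {c : ℝ} (he : ‖e‖ ≤ c) (x : ℝ) :
    ‖∑' n, neumannTerm P μ D e n x‖ ≤ 2 * c * volterraWeight m x := by
  have hs : HasSum (fun n : ℕ => c * (1 / 2 : ℝ) ^ n * volterraWeight m x)
      (c * 2 * volterraWeight m x) := by
    have := hasSum_geometric_two
    exact (this.mul_left c).mul_right _
  have := tsum_of_norm_bounded hs fun n => V.norm_neumannTerm_le he n x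
  linarith

lemma continuous_tsum_neumannTerm (hP : P * P = P) (e : E) :
    Continuous fun x => ∑' n, neumannTerm P μ D e n x := by
  refine continuous_iff_continuousAt.2 fun x => ?_
  have : ContinuousOn (fun x => ∑' n, neumannTerm P μ D e n x) (Iic (x + 1)) := by
    refine continuousOn_tsum (u := fun n => ‖e‖ * (1 / 2) ^ n * volterraWeight m (x + 1))
      (fun n => (V.continuous_neumannTerm hP e n).continuousOn)
      (((summable_geometric_of_lt_one (by norm_num) (by norm_num)).mul_left _).mul_right _)
      fun n y hy => (V.norm_neumannTerm_le le_rfl n y).trans ?_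
    have := volterraWeight_mono V.intm V.m_nonneg (hy : y ≤ x + 1)
    gcongr
  exact this.continuousAt (Iic_mem_nhds (by linarith))

/-- The geometric bounds make the integrals of the norms summable, so the sum may be exchanged with
the integral. -/
lemma tsum_neumannTerm_eq (hP : P * P = P) (e : E) (x : ℝ) :
    ∑' n, neumannTerm P μ D e n x =
      e + volterraOp P μ D (fun x => ∑' n, neumannTerm P μ D e n x) x := by
  rw [(V.summable_neumannTerm e x).tsum_eq_zero_add]
  congr 1
  have hb := fun n => V.norm_neumannTerm_le (e := e) le_rfl n
  have hi : ∀ n, IntegrableOn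
      (fun y => projKernel P μ (x - y) (D y (neumannTerm P μ D e n y))) (Iic x) := fun n =>
    V.integrableOn_integrand (V.continuous_neumannTerm hP e n) fun y _ => hb n y
  have hsum : Summable fun n => ∫ y in Iic x,
      ‖projKernel P μ (x - y) (D y (neumannTerm P μ D e n y))‖ := by
    refine Summable.of_nonneg_of_le (fun n => integral_nonneg fun _ => norm_nonneg _)
      (f := fun n => ‖e‖ * (1 / 2) ^ n * ((volterraWeight m x - 1) / 2)) (fun n => ?_)
      (((summable_geometric_of_lt_one (by norm_num) (by norm_num)).mul_left _).mul_right _)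
    rw [← V.integral_mul_weight]
    refine setIntegral_mono_on (hi n).norm (V.integrableOn_mul_weight _ x) measurableSet_Iic
      fun y hy => V.norm_integrand_le hy (hb n y)
  rw [volterraOp]
  have := hasSum_integral_of_summable_integral_norm hi hsum
  refine this.tsum_eq.trans ?_
  refine integral_congr_ae (ae_of_all _ fun y => ?_)
  simp only
  rw [(D y).map_tsum (V.summable_neumannTerm e y), ContinuousLinearMap.map_tsum]
  exact (V.summable_neumannTerm e y).map (D y) (D y).continuous

end IsVolterra

end Volterra

/-! ### The associated differential equation: existence, uniqueness and holomorphic dependence -/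

section Volterra

variable {E : Type*} [NormedAddCommGroup E] [NormedSpace ℂ E]

lemma exists_norm_le_of_tendsto_atBot {F : Type*} [NormedAddCommGroup F] {h : ℝ → F} {l : F}
    (hc : Continuous h) (hl : Tendsto h atBot (𝓝 l)) (x : ℝ) : ∃ C, ∀ y ≤ x, ‖h y‖ ≤ C := by
  have h1 : ∀ᶠ y in atBot, ‖h y‖ < ‖l‖ + 1 := hl.norm.eventually_lt_const (by linarith)
  obtain ⟨b, hb⟩ := eventually_atBot.1 h1
  obtain ⟨C, hC⟩ := (isCompact_Icc (a := b) (b := x)).exists_bound_of_continuousOn hc.continuousOn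
  refine ⟨max (‖l‖ + 1) C, fun y hy => ?_⟩
  rcases le_total y b with h | h
  · exact (hb y h).le.trans (le_max_left _ _)
  · exact (hC y ⟨h, hy⟩).trans (le_max_right _ _)

namespace IsVolterra

variable {P : E →L[ℂ] E} {μ : ℂ} {D : ℝ → E →L[ℂ] E} {m : ℝ → ℝ} (V : IsVolterra P μ D m)
  [CompleteSpace E]

include V

/-- The condition P e = 0 says that the constant e solves the unperturbed equation h' = μPh. -/
lemma tsum_neumannTerm_solves (hP : P * P = P) {e : E} (he : P e = 0) :
    (∀ x, HasDerivAt (fun x => ∑' n, neumannTerm P μ D e n x)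
      (μ • P (∑' n, neumannTerm P μ D e n x) + D x (∑' n, neumannTerm P μ D e n x)) x) ∧
    Tendsto (fun x => ∑' n, neumannTerm P μ D e n x) atBot (𝓝 e) := by
  set h : ℝ → E := fun x => ∑' n, neumannTerm P μ D e n x with hh
  have heq : ∀ x, h x = e + volterraOp P μ D h x := V.tsum_neumannTerm_eq hP e
  have hb : ∀ x, ‖h x‖ ≤ 2 * ‖e‖ * volterraWeight m x := V.norm_tsum_neumannTerm_le le_rfl
  constructor
  · intro x
    have h1 := (V.hasDerivAt_volterraOp hP (V.continuous_tsum_neumannTerm hP e) hb x).const_add e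
    have h2 : h = fun x => e + volterraOp P μ D h x := funext heq
    rw [h2]
    refine h1.congr_deriv ?_
    have h3 : P (h x) = P (volterraOp P μ D h x) := by rw [heq x, map_add, he, zero_add]
    change _ = μ • P (h x) + D x (h x)
    rw [h3]
  · rw [tendsto_iff_norm_sub_tendsto_zero]
    have hw : Tendsto (fun x => 2 * ‖e‖ * ((volterraWeight m x - 1) / 2)) atBot (𝓝 0) := by
      have := (((tendsto_volterraWeight_atBot m).sub_const 1).div_const 2).const_mul (2 * ‖e‖)
      simpa using this
    refine squeeze_zero (fun _ => norm_nonneg _) (fun x => ?_) hw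
    rw [heq x, add_sub_cancel_left]
    exact V.norm_volterraOp_le_sub fun y _ => hb y

lemma eq_zero_of_tendsto_zero {h : ℝ → E}
    (hd : ∀ x, HasDerivAt h (μ • P (h x) + D x (h x)) x) (hP : P * P = P)
    (hl : Tendsto h atBot (𝓝 0)) : h = 0 := by
  have hPP : ∀ v, P (P v) = P v := fun v => by
    have := congrArg (fun A : E →L[ℂ] E => A v) hP
    simpa using this
  have hc : Continuous h := continuous_iff_continuousAt.2 fun x => (hd x).continuousAt
  have hbd := exists_norm_le_of_tendsto_atBot hc hl
  refine V.eq_zero_of_eq_volterraOp hbd fun x => ?_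
  obtain ⟨C, hC⟩ := hbd x
  have hC0 : 0 ≤ C := (norm_nonneg _).trans (hC x le_rfl)
  -- Variation of constants: the propagator cancels the term μP, leaving only the perturbation,
  -- which is integrated from -∞ to x.
  have hderiv : ∀ y ∈ Iic x, HasDerivAt (fun y : ℝ => projKernel P μ (x - y) (h y))
      (projKernel P μ (x - y) (D y (h y))) y := by
    intro y _
    have h1 : HasDerivAt (fun y : ℝ => exp (μ * ((x - y : ℝ) : ℂ)))
        (-(μ * exp (μ * ((x - y : ℝ) : ℂ)))) y := by
      have := (((hasDerivAt_id (y : ℂ)).const_sub (x : ℂ)).const_mul μ).cexp.comp_ofReal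
      refine (this.congr_deriv ?_).congr_of_eventuallyEq (.of_forall fun y => ?_)
      · push_cast; simp [mul_comm]
      · simp
    have h2 := (((1 - P).restrictScalars ℝ).hasFDerivAt.comp_hasDerivAt y (hd y)).add
      (h1.smul ((P.restrictScalars ℝ).hasFDerivAt.comp_hasDerivAt y (hd y)))
    have h3 : HasDerivAt (fun y : ℝ => projKernel P μ (x - y) (h y)) _ y := h2
    refine h3.congr_deriv ?_
    simp only [projKernel, Function.comp_apply, map_add, map_smul, _root_.add_apply,
      _root_.smul_apply, hPP, _root_.sub_apply, one_apply_eq_self,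
      ContinuousLinearMap.coe_restrictScalars']
    module
  have hint := V.integrableOn_integrand (c := C) (x := x) hc fun y hy => (hC y hy).trans
    (le_mul_of_one_le_right hC0 (one_le_volterraWeight V.m_nonneg y))
  have hlim : Tendsto (fun y : ℝ => projKernel P μ (x - y) (h y)) atBot (𝓝 0) := by
    rw [tendsto_zero_iff_norm_tendsto_zero]
    have h0 : Tendsto (fun y => (‖1 - P‖ + ‖P‖) * ‖h y‖) atBot (𝓝 0) := by
      simpa using hl.norm.const_mul (‖1 - P‖ + ‖P‖)
    refine squeeze_zero' (.of_forall fun _ => norm_nonneg _) ?_ h0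
    filter_upwards [eventually_le_atBot x] with y hy
    exact (ContinuousLinearMap.le_opNorm _ _).trans (mul_le_mul_of_nonneg_right
      (norm_projKernel_le P V.re_nonpos (sub_nonneg.2 hy)) (norm_nonneg _))
  have := integral_Iic_of_hasDerivAt_of_tendsto' hderiv hint hlim
  rw [volterraOp, this]
  simp [projKernel]

end IsVolterra

/-- Differentiation under the integral sign: an integral of holomorphic functions with a common
integrable bound is holomorphic. -/
lemma differentiableOn_integral_of_dominated [CompleteSpace E] {α : Type*} [MeasurableSpace α]
    {ν : Measure α} {F : ℂ → α → E} {U : Set ℂ} (hU : IsOpen U) {bound : α → ℝ}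
    (hbi : Integrable bound ν) (hm : ∀ ζ ∈ U, AEStronglyMeasurable (F ζ) ν)
    (hb : ∀ᵐ y ∂ν, ∀ ζ ∈ U, ‖F ζ y‖ ≤ bound y)
    (hd : ∀ᵐ y ∂ν, DifferentiableOn ℂ (fun ζ => F ζ y) U) :
    DifferentiableOn ℂ (fun ζ => ∫ y, F ζ y ∂ν) U := by
  intro ζ₀ hζ₀
  obtain ⟨R, hR, hRU⟩ := Metric.isOpen_iff.1 hU ζ₀ hζ₀
  -- Closed r-balls about points of the r-ball at ζ₀ lie within distance 2R/3 of ζ₀, hence in U. The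
  -- Cauchy estimate on them bounds the ζ-derivative by `bound y / r`.
  set r := R / 3 with hr
  have hr0 : 0 < r := by positivity
  have hsub : ∀ ζ ∈ Metric.ball ζ₀ r, Metric.closedBall ζ r ⊆ U := fun ζ hζ w hw => hRU <| by
    rw [Metric.mem_ball] at hζ ⊢
    rw [Metric.mem_closedBall] at hw
    linarith [dist_triangle w ζ ζ₀]
  have hballU : Metric.ball ζ₀ r ⊆ U := fun ζ hζ =>
    hsub ζ hζ (Metric.mem_closedBall_self hr0.le)
  refine (hasDerivAt_integral_of_dominated_loc_of_deriv_le (𝕜 := ℂ) (F := F)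
    (F' := fun ζ y => deriv (fun ζ => F ζ y) ζ) (bound := fun y => bound y / r)
    (Metric.ball_mem_nhds ζ₀ hr0) ?_ ?_ ?_ ?_ (hbi.div_const r)
    ?_).2.differentiableAt.differentiableWithinAt
  · filter_upwards [hU.mem_nhds hζ₀] with ζ hζ using hm ζ hζ
  · exact hbi.mono' (hm ζ₀ hζ₀) (hb.mono fun y hy => hy ζ₀ hζ₀)
  -- The derivative is measurable in y as a limit of difference quotients along a sequence. The
  -- denominator n + 2 keeps all points, including n = 0, strictly inside the ball.
  · have hseq : Tendsto (fun n : ℕ => ζ₀ + ((r / (n + 2) : ℝ) : ℂ)) atTop (𝓝[≠] ζ₀) := by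
      rw [tendsto_nhdsWithin_iff]
      constructor
      · have h1 : Tendsto (fun n : ℕ => r / ((n : ℝ) + 2)) atTop (𝓝 0) :=
          tendsto_const_nhds.div_atTop (tendsto_atTop_add_const_right _ _ tendsto_natCast_atTop_atTop)
        have h2 := ((continuous_ofReal.tendsto 0).comp h1).const_add ζ₀
        simpa [Function.comp_def] using h2
      · refine .of_forall fun n => ?_
        have : (r / ((n : ℝ) + 2)) ≠ 0 := by positivity
        exact add_ne_left.2 (ofReal_ne_zero.2 this)
    have hmem : ∀ n : ℕ, ζ₀ + ((r / (n + 2) : ℝ) : ℂ) ∈ U := fun n => hballU <| by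
      rw [Metric.mem_ball, dist_self_add_left, norm_real, Real.norm_of_nonneg (by positivity)]
      exact div_lt_self hr0 (by linarith [(n.cast_nonneg : (0 : ℝ) ≤ n)])
    refine aestronglyMeasurable_of_tendsto_ae atTop
      (f := fun n : ℕ => fun y => slope (fun ζ => F ζ y) ζ₀ (ζ₀ + ((r / (n + 2) : ℝ) : ℂ))) ?_ ?_
    · intro n
      simp only [slope_def_module]
      exact ((hm _ (hmem n)).sub (hm _ hζ₀)).const_smul _
    · filter_upwards [hd] with y hy
      have := ((hy.differentiableAt (hU.mem_nhds hζ₀)).hasDerivAt)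
      exact (hasDerivAt_iff_tendsto_slope.1 this).comp hseq
  · filter_upwards [hb, hd] with y hy hyd ζ hζ
    refine Complex.norm_deriv_le_of_forall_mem_sphere_norm_le hr0 ?_ fun w hw =>
      hy w (hsub ζ hζ (Metric.sphere_subset_closedBall hw))
    refine DifferentiableOn.diffContOnCl ?_
    rw [closure_ball _ hr0.ne']
    exact hyd.mono (hsub ζ hζ)
  · filter_upwards [hd] with y hy ζ hζ
    exact (hy.differentiableAt (hU.mem_nhds (hballU hζ))).hasDerivAt

section Parameter

variable [CompleteSpace E] {P : ℂ → E →L[ℂ] E} {μ : ℂ → ℂ} {D : ℝ → E →L[ℂ] E} {m : ℝ → ℝ}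
  {e : ℂ → E} {U : Set ℂ} {c : ℝ}

/-- The perturbation D and the majorant m are shared by all ζ in U, so one integrable bound
dominates every integrand and induction on n passes through the integral. -/
lemma differentiableOn_neumannTerm (hU : IsOpen U) (V : ∀ ζ ∈ U, IsVolterra (P ζ) (μ ζ) D m)
    (hP : ∀ ζ ∈ U, P ζ * P ζ = P ζ) (hc : ∀ ζ ∈ U, ‖e ζ‖ ≤ c) (hPd : DifferentiableOn ℂ P U)
    (hμd : DifferentiableOn ℂ μ U) (hed : DifferentiableOn ℂ e U) (n : ℕ) (x : ℝ) :
    DifferentiableOn ℂ (fun ζ => neumannTerm (P ζ) (μ ζ) D (e ζ) n x) U := by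
  induction n generalizing x with
  | zero => exact hed
  | succ n ih =>
    rcases U.eq_empty_or_nonempty with rfl | ⟨ζ₁, hζ₁⟩
    · exact differentiableOn_empty
    refine differentiableOn_integral_of_dominated hU
      ((V ζ₁ hζ₁).integrableOn_mul_weight (c * (1 / 2) ^ n) x) (fun ζ hζ => ?_) ?_ ?_
    · exact ((V ζ hζ).continuous_integrand
        ((V ζ hζ).continuous_neumannTerm (hP ζ hζ) _ n) x).aestronglyMeasurable
    · filter_upwards [ae_restrict_mem measurableSet_Iic] with y hy ζ hζ
      exact (V ζ hζ).norm_integrand_le hy ((V ζ hζ).norm_neumannTerm_le (hc ζ hζ) n y)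
    · refine ae_of_all _ fun y => ?_
      have h1 : DifferentiableOn ℂ (fun ζ => projKernel (P ζ) (μ ζ) (x - y)) U :=
        (hPd.const_sub 1).add (((hμd.mul_const _).cexp).smul hPd)
      exact h1.clm_apply ((D y).differentiable.comp_differentiableOn (ih y))

lemma differentiableOn_tsum_neumannTerm (hU : IsOpen U)
    (V : ∀ ζ ∈ U, IsVolterra (P ζ) (μ ζ) D m)
    (hP : ∀ ζ ∈ U, P ζ * P ζ = P ζ) (hc : ∀ ζ ∈ U, ‖e ζ‖ ≤ c) (hPd : DifferentiableOn ℂ P U)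
    (hμd : DifferentiableOn ℂ μ U) (hed : DifferentiableOn ℂ e U) (x : ℝ) :
    DifferentiableOn ℂ (fun ζ => ∑' n, neumannTerm (P ζ) (μ ζ) D (e ζ) n x) U :=
  differentiableOn_tsum_of_summable_norm
    (((summable_geometric_of_lt_one (by norm_num) (by norm_num)).mul_left c).mul_right
      (volterraWeight m x))
    (fun n => differentiableOn_neumannTerm hU V hP hc hPd hμd hed n x) hU
    fun n ζ hζ => (V ζ hζ).norm_neumannTerm_le (hc ζ hζ) n x

end Parameter

end Volterra

/-! ### Jost solutions of the Zakharov-Shabat system at -∞ -/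

section ZakharovShabat

/-- The coefficient matrix of a Zakharov-Shabat system with potential `q`, spectral parameter `k`
and a real shift `s` of the spectral parameter. -/
noncomputable def zsMatrix (q : ℝ → ℂ) (s : ℝ → ℝ) (k : ℂ) (x : ℝ) : Matrix (Fin 2) (Fin 2) ℂ :=
  !![-(I * (k + s x)), q x; (starRingEnd ℂ) (q x), I * (k + s x)]

/-- `f` solves the Zakharov-Shabat system. -/
def IsZS (q : ℝ → ℂ) (s : ℝ → ℝ) (k : ℂ) (f : ℝ → Fin 2 → ℂ) : Prop :=
  ∀ x, HasDerivAt f (zsMatrix q s k x *ᵥ f x) x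

/-- The potential `q` and the shift `s` are continuous and tend to `qm` and `0` at `-∞` in the
sense of integrable differences. -/
structure IsTail (p : Params) (q : ℝ → ℂ) (s : ℝ → ℝ) (qm : ℂ) : Prop where
  contq : Continuous q
  conts : Continuous s
  intq : IntegrableOn (fun x => q x - qm) (Iic 0)
  ints : IntegrableOn s (Iic 0)
  norm_qm : ‖qm‖ = p.q₀

/-- The eigenvector of the limiting system at `-∞` for the eigenvalue `-i lam`. -/
noncomputable def jostLimit (qm ζ : ℂ) : Fin 2 → ℂ := ![1, I * (starRingEnd ℂ) qm * ζ⁻¹]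

/-- `f` is the solution with the behaviour `e^{-i lam x} jostLimit` at `-∞`. -/
def IsJost (p : Params) (q : ℝ → ℂ) (s : ℝ → ℝ) (qm ζ : ℂ) (f : ℝ → Fin 2 → ℂ) : Prop :=
  IsZS q s (kappa p ζ) f ∧
    Tendsto (fun x : ℝ => exp (I * lam p ζ * x) • f x) atBot (𝓝 (jostLimit qm ζ))

/-- A matrix as a continuous linear map. -/
noncomputable def matCLM : Matrix (Fin 2) (Fin 2) ℂ →ₗ[ℂ] (Fin 2 → ℂ) →L[ℂ] (Fin 2 → ℂ) :=
  (LinearMap.toContinuousLinearMap : ((Fin 2 → ℂ) →ₗ[ℂ] (Fin 2 → ℂ)) ≃ₗ[ℂ] _).toLinearMap ∘ₗ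
    (Matrix.toLin' : Matrix (Fin 2) (Fin 2) ℂ ≃ₗ[ℂ] _).toLinearMap

@[simp] lemma matCLM_apply (M : Matrix (Fin 2) (Fin 2) ℂ) (v : Fin 2 → ℂ) :
    matCLM M v = M *ᵥ v := by
  simp [matCLM]

lemma matCLM_eq (a b c d : ℂ) : matCLM !![a, b; c, d] = a • matCLM (single 0 0 1) +
    b • matCLM (single 0 1 1) + c • matCLM (single 1 0 1) + d • matCLM (single 1 1 1) := by
  simp only [← map_smul, ← map_add]
  congr 1
  ext i j
  fin_cases i <;> fin_cases j <;> simp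

/-- The projection onto the eigenvector for `i lam` along `jostLimit`. -/
noncomputable def jostProj (p : Params) (qm ζ : ℂ) : Matrix (Fin 2) (Fin 2) ℂ :=
  (2 * I * lam p ζ)⁻¹ • !![-(I * p.q₀ ^ 2 * ζ⁻¹), qm; (starRingEnd ℂ) qm, I * ζ]

/-- The difference between the system and its limit at `-∞`. -/
noncomputable def tailMatrix (q : ℝ → ℂ) (s : ℝ → ℝ) (qm : ℂ) (x : ℝ) :
    Matrix (Fin 2) (Fin 2) ℂ :=
  !![-(I * s x), q x - qm; (starRingEnd ℂ) (q x - qm), I * s x]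

variable {p : Params} {q : ℝ → ℂ} {s : ℝ → ℝ} {qm ζ : ℂ}

lemma lam_ne_zero (h0 : ζ ≠ 0) (h1 : ζ ≠ p.q₀) (h2 : ζ ≠ -p.q₀) : lam p ζ ≠ 0 := by
  intro h
  have h3 : ζ ^ 2 - (p.q₀ : ℂ) ^ 2 = 2 * ζ * lam p ζ := by
    rw [lam]; field_simp
  rw [h, mul_zero, sq_sub_sq] at h3
  rcases mul_eq_zero.1 h3 with h | h
  · exact h2 (eq_neg_of_add_eq_zero_left h)
  · exact h1 (sub_eq_zero.1 h)

lemma im_lam (p : Params) (ζ : ℂ) : (lam p ζ).im = ζ.im * (1 + p.q₀ ^ 2 / normSq ζ) / 2 := by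
  have : ((p.q₀ : ℂ) ^ 2 * ζ⁻¹).im = p.q₀ ^ 2 * (-ζ.im / normSq ζ) := by
    rw [← ofReal_pow, im_ofReal_mul, inv_im]
  have h2 : lam p ζ = ((1 / 2 : ℝ) : ℂ) * (ζ - p.q₀ ^ 2 * ζ⁻¹) := by
    rw [lam]; push_cast; ring
  rw [h2, im_ofReal_mul, sub_im, this]
  ring

lemma im_lam_nonneg (p : Params) (h : 0 ≤ ζ.im) : 0 ≤ (lam p ζ).im := by
  rw [im_lam]
  have := normSq_nonneg ζ
  positivity

lemma im_lam_pos (p : Params) (h : 0 < ζ.im) : 0 < (lam p ζ).im := by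
  rw [im_lam]
  have := normSq_nonneg ζ
  positivity

lemma mem_scatDomain_of_im_pos (p : Params) (h : 0 < ζ.im) : ζ ∈ scatDomain p := by
  refine ⟨h.le, ?_, ?_, ?_⟩ <;> rintro rfl <;> simp at h

namespace IsTail

variable (hT : IsTail p q s qm)

include hT

lemma conj_mul : (starRingEnd ℂ) qm * qm = (p.q₀ : ℂ) ^ 2 := by
  rw [mul_comm, Complex.mul_conj, normSq_eq_norm_sq, hT.norm_qm]; push_cast; rfl

/-- The limiting matrix L has L² = -λ², so (iλ + L)² = 2iλ(iλ + L). Division by 2iλ requires λ ≠ 0,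
hence the exclusion of ±q₀. -/
lemma jostProj_idem (hζ : ζ ∈ scatDomain p) :
    matCLM (jostProj p qm ζ) * matCLM (jostProj p qm ζ) = matCLM (jostProj p qm ζ) := by
  obtain ⟨-, h0, h1, h2⟩ := hζ
  have hl := lam_ne_zero h0 h1 h2
  have hM : jostProj p qm ζ * jostProj p qm ζ = jostProj p qm ζ := by
    have key : (!![-(I * p.q₀ ^ 2 * ζ⁻¹), qm; (starRingEnd ℂ) qm, I * ζ] : Matrix _ _ ℂ) *
        !![-(I * p.q₀ ^ 2 * ζ⁻¹), qm; (starRingEnd ℂ) qm, I * ζ] = (2 * I * lam p ζ) •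
        !![-(I * p.q₀ ^ 2 * ζ⁻¹), qm; (starRingEnd ℂ) qm, I * ζ] := by
      have hc := hT.conj_mul
      have hII := I_mul_I
      have hz := mul_inv_cancel₀ h0
      ext i j
      fin_cases i <;> fin_cases j <;> simp [Matrix.mul_apply, Fin.sum_univ_two, lam]
      · linear_combination hc + p.q₀ ^ 2 * hz * I ^ 2 + p.q₀ ^ 2 * hII
      · ring
      · ring
      · linear_combination hc + p.q₀ ^ 2 * hz * I ^ 2 + p.q₀ ^ 2 * hII
    simp only [jostProj, Matrix.smul_mul, Matrix.mul_smul, key, smul_smul]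
    congr 1
    field_simp
  ext1 v
  rw [mul_apply_eq_comp, matCLM_apply, matCLM_apply, mulVec_mulVec, hM]

lemma jostProj_jostLimit (hζ : ζ ≠ 0) : matCLM (jostProj p qm ζ) (jostLimit qm ζ) = 0 := by
  have hc := hT.conj_mul
  rw [matCLM_apply, jostProj, smul_mulVec]
  convert smul_zero _
  ext i
  fin_cases i <;> simp [jostLimit, Matrix.mulVec, dotProduct, Fin.sum_univ_two]
  · linear_combination I * ζ⁻¹ * hc
  · linear_combination (starRingEnd ℂ) qm * (mul_inv_cancel₀ hζ) * I ^ 2 +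
      (starRingEnd ℂ) qm * I_mul_I

omit hT in
lemma add_tailMatrix (hζ : ζ ∈ scatDomain p) (x : ℝ) :
    (2 * I * lam p ζ) • jostProj p qm ζ + tailMatrix q s qm x =
      (I * lam p ζ) • (1 : Matrix (Fin 2) (Fin 2) ℂ) + zsMatrix q s (kappa p ζ) x := by
  obtain ⟨-, h0, h1, h2⟩ := hζ
  have hl := lam_ne_zero h0 h1 h2
  rw [jostProj, smul_smul, mul_inv_cancel₀ (by simp [hl]), one_smul]
  ext i j
  fin_cases i <;> fin_cases j <;> simp [tailMatrix, zsMatrix, kappa, lam] <;> ring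

lemma continuous_tailMatrix : Continuous fun x => matCLM (tailMatrix q s qm x) := by
  have h1 := hT.contq
  have h2 := hT.conts
  simp only [tailMatrix]
  simp_rw [matCLM_eq]
  have h3 : Continuous fun x => (starRingEnd ℂ) (q x - qm) :=
    continuous_conj.comp (h1.sub continuous_const)
  fun_prop

lemma integrableOn_norm_tailMatrix (x : ℝ) :
    IntegrableOn (fun x => ‖matCLM (tailMatrix q s qm x)‖) (Iic x) := by
  refine integrableOn_Iic_of_continuous hT.continuous_tailMatrix.norm (a := 0) (Integrable.norm ?_) x
  simp only [tailMatrix]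
  simp_rw [matCLM_eq]
  have h1 : IntegrableOn (fun x => I * (s x : ℂ)) (Iic 0) := hT.ints.ofReal.const_mul I
  have h2 : IntegrableOn (fun x => (starRingEnd ℂ) (q x - qm)) (Iic 0) :=
    (conjCLE : ℂ →L[ℝ] ℂ).integrable_comp hT.intq
  exact (((h1.neg.smul_const _).add (hT.intq.smul_const _)).add (h2.smul_const _)).add
    (h1.smul_const _)

/-- The constant C is left free so that the same majorant can serve a whole neighbourhood of ζ. -/
lemma isVolterra (hζ : ζ ∈ scatDomain p) {C : ℝ}
    (hC : ‖1 - matCLM (jostProj p qm ζ)‖ + ‖matCLM (jostProj p qm ζ)‖ ≤ C) :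
    IsVolterra (matCLM (jostProj p qm ζ)) (2 * I * lam p ζ) (fun x => matCLM (tailMatrix q s qm x))
      (fun x => C * ‖matCLM (tailMatrix q s qm x)‖) where
  re_nonpos := by
    have := im_lam_nonneg p hζ.1
    simpa [mul_assoc] using this
  contD := hT.continuous_tailMatrix
  contm := hT.continuous_tailMatrix.norm.const_mul C
  intm x := (hT.integrableOn_norm_tailMatrix x).const_mul C
  bound y := by gcongr

end IsTail

lemma hasDerivAt_exp_smul {f : ℝ → Fin 2 → ℂ} {M : Matrix (Fin 2) (Fin 2) ℂ} {x : ℝ} (c : ℂ)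
    (h : HasDerivAt f (M *ᵥ f x) x) :
    HasDerivAt (fun x : ℝ => exp (c * x) • f x)
      ((c • (1 : Matrix (Fin 2) (Fin 2) ℂ) + M) *ᵥ (exp (c * x) • f x)) x := by
  have hexp : HasDerivAt (fun x : ℝ => exp (c * x)) (c * exp (c * x)) x := by
    have := ((hasDerivAt_id (x : ℂ)).const_mul c).cexp.comp_ofReal
    simpa [mul_comm] using this
  refine (hexp.smul h).congr_deriv ?_
  rw [add_mulVec, smul_mulVec, one_mulVec, mulVec_smul, smul_smul, add_comm]

/-- Removing e^{-iλx} brings the system to the form h' = μPh + Dh, with μ = 2iλ and D independent of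
ζ. -/
lemma IsJost.gauge {f : ℝ → Fin 2 → ℂ} (hζ : ζ ∈ scatDomain p) (hf : IsZS q s (kappa p ζ) f)
    (x : ℝ) : HasDerivAt (fun x : ℝ => exp (I * lam p ζ * x) • f x)
      ((2 * I * lam p ζ) • matCLM (jostProj p qm ζ) (exp (I * lam p ζ * x) • f x) +
        matCLM (tailMatrix q s qm x) (exp (I * lam p ζ * x) • f x)) x := by
  refine (hasDerivAt_exp_smul (I * lam p ζ) (hf x)).congr_deriv ?_
  rw [← IsTail.add_tailMatrix (qm := qm) hζ, matCLM_apply, matCLM_apply, add_mulVec, smul_mulVec]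

lemma IsJost.unique (hT : IsTail p q s qm) (hζ : ζ ∈ scatDomain p) {f g : ℝ → Fin 2 → ℂ}
    (hf : IsJost p q s qm ζ f) (hg : IsJost p q s qm ζ g) : f = g := by
  have h := (hT.isVolterra hζ le_rfl).eq_zero_of_tendsto_zero
    (h := fun x : ℝ => exp (I * lam p ζ * x) • f x - exp (I * lam p ζ * x) • g x) (fun x => ?_)
    (hT.jostProj_idem hζ) ?_
  · funext x
    have := congrFun h x
    simp only [← smul_sub, Pi.zero_apply, smul_eq_zero, exp_ne_zero, false_or] at this
    exact sub_eq_zero.1 this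
  · refine ((IsJost.gauge (qm := qm) hζ hf.1 x).sub (IsJost.gauge (qm := qm) hζ hg.1 x)).congr_deriv ?_
    simp only [map_sub, smul_sub]
    abel
  · simpa using hf.2.sub hg.2

/-- The Jost solution, as a Neumann series. -/
noncomputable def jostSeries (p : Params) (q : ℝ → ℂ) (s : ℝ → ℝ) (qm ζ : ℂ) (x : ℝ) : Fin 2 → ℂ :=
  exp (-(I * lam p ζ) * x) • ∑' n, neumannTerm (matCLM (jostProj p qm ζ)) (2 * I * lam p ζ)
    (fun x => matCLM (tailMatrix q s qm x)) (jostLimit qm ζ) n x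

lemma IsTail.isJost_jostSeries (hT : IsTail p q s qm) (hζ : ζ ∈ scatDomain p) :
    IsJost p q s qm ζ (jostSeries p q s qm ζ) := by
  obtain ⟨h1, h2⟩ := (hT.isVolterra hζ le_rfl).tsum_neumannTerm_solves (hT.jostProj_idem hζ)
    (hT.jostProj_jostLimit hζ.2.1)
  constructor
  · intro x
    have h3 := h1 x
    rw [matCLM_apply, matCLM_apply, ← smul_mulVec, ← add_mulVec, IsTail.add_tailMatrix hζ] at h3
    refine (hasDerivAt_exp_smul (-(I * lam p ζ)) h3).congr_deriv ?_
    rw [← add_assoc, ← add_smul, neg_add_cancel, zero_smul, zero_add, jostSeries]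
  · refine h2.congr fun x => ?_
    rw [jostSeries, smul_smul, ← Complex.exp_add]
    simp

lemma differentiableAt_lam (p : Params) (hζ : ζ ≠ 0) : DifferentiableAt ℂ (lam p) ζ := by
  have : DifferentiableAt ℂ (fun ζ : ℂ => (ζ - p.q₀ ^ 2 * ζ⁻¹) / 2) ζ := by fun_prop (disch := assumption)
  exact this

lemma differentiableAt_jostProj (hζ : ζ ∈ scatDomain p) :
    DifferentiableAt ℂ (fun ζ => matCLM (jostProj p qm ζ)) ζ := by
  obtain ⟨-, h0, h1, h2⟩ := hζ
  have hl := lam_ne_zero h0 h1 h2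
  have hd := differentiableAt_lam p h0
  simp only [jostProj, map_smul]
  simp_rw [matCLM_eq]
  have : DifferentiableAt ℂ (fun ζ => (2 * I * lam p ζ)⁻¹) ζ := by
    refine DifferentiableAt.inv (by fun_prop) (by simp [hl])
  fun_prop (disch := assumption)

lemma differentiableAt_jostLimit (hζ : ζ ≠ 0) : DifferentiableAt ℂ (jostLimit qm) ζ := by
  refine differentiableAt_pi.2 fun i => ?_
  fin_cases i <;> simp [jostLimit]
  exact (differentiableAt_inv hζ).const_mul _

lemma isOpen_upper : IsOpen {ζ : ℂ | 0 < ζ.im} := isOpen_lt continuous_const continuous_im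

/-- Near a point of the open upper half plane the Jost solutions are holomorphic in `ζ` and decay
exponentially at `-∞`, uniformly in `ζ`. -/
lemma IsTail.exists_local (hT : IsTail p q s qm) {F : ℂ → ℝ → Fin 2 → ℂ}
    (hF : ∀ ζ, 0 < ζ.im → IsJost p q s qm ζ (F ζ)) (hζ : 0 < ζ.im) :
    (∀ x, DifferentiableAt ℂ (fun ζ => F ζ x) ζ) ∧
      ∃ C c : ℝ, 0 < c ∧ ∀ᶠ ζ' in 𝓝 ζ, ∀ x ≤ 0, ‖F ζ' x‖ ≤ C * Real.exp (c * x) := by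
  have hζd := mem_scatDomain_of_im_pos p hζ
  have hPc := (differentiableAt_jostProj (qm := qm) hζd).continuousAt
  -- Slack in B, c and e makes the three bounds open conditions, valid uniformly on a neighbourhood
  -- U.
  set B : ℝ := ‖1 - matCLM (jostProj p qm ζ)‖ + ‖matCLM (jostProj p qm ζ)‖ + 1 with hB
  set c : ℝ := (lam p ζ).im / 2 with hc
  set e : ℝ := ‖jostLimit qm ζ‖ + 1 with he
  have hlp := im_lam_pos p hζ
  have ev1 : ∀ᶠ ζ' in 𝓝 ζ, ‖1 - matCLM (jostProj p qm ζ')‖ + ‖matCLM (jostProj p qm ζ')‖ < B :=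
    ((continuousAt_const.sub hPc).norm.add hPc.norm).eventually_lt_const (lt_add_one _)
  have ev2 : ∀ᶠ ζ' in 𝓝 ζ, ‖jostLimit qm ζ'‖ < e :=
    (differentiableAt_jostLimit hζd.2.1).continuousAt.norm.eventually_lt_const (lt_add_one _)
  have ev3 : ∀ᶠ ζ' in 𝓝 ζ, c < (lam p ζ').im :=
    (continuous_im.continuousAt.comp (differentiableAt_lam p hζd.2.1).continuousAt).eventually_const_lt
      (half_lt_self hlp)
  obtain ⟨U, hUs, hUo, hζU⟩ := eventually_nhds_iff.1
    (ev1.and (ev2.and (ev3.and (isOpen_upper.mem_nhds hζ))))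
  replace hUs : ∀ ζ' ∈ U, _ := hUs
  have hUd : ∀ ζ' ∈ U, ζ' ∈ scatDomain p := fun ζ' h => mem_scatDomain_of_im_pos p (hUs ζ' h).2.2.2
  have hV : ∀ ζ' ∈ U, _ := fun ζ' h => hT.isVolterra (hUd ζ' h) (hUs ζ' h).1.le
  -- Uniqueness identifies the family F, which may be chosen abstractly for each ζ', with the
  -- explicit series, whose dependence on ζ' is known.
  have hFeq : ∀ ζ' ∈ U, F ζ' = jostSeries p q s qm ζ' := fun ζ' h =>
    IsJost.unique hT (hUd ζ' h) (hF ζ' (hUs ζ' h).2.2.2) (hT.isJost_jostSeries (hUd ζ' h))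
  have hlamU : DifferentiableOn ℂ (lam p) U := fun ζ' h =>
    (differentiableAt_lam p (hUd ζ' h).2.1).differentiableWithinAt
  constructor
  · intro x
    have h1 := differentiableOn_tsum_neumannTerm hUo hV
      (fun ζ' h => hT.jostProj_idem (hUd ζ' h)) (fun ζ' h => (hUs ζ' h).2.1.le)
      (fun ζ' h => (differentiableAt_jostProj (hUd ζ' h)).differentiableWithinAt)
      (hlamU.const_mul _)
      (fun ζ' h => (differentiableAt_jostLimit (hUd ζ' h).2.1).differentiableWithinAt) x
    have h2 : DifferentiableOn ℂ (fun ζ => jostSeries p q s qm ζ x) U :=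
      (((hlamU.const_mul I).neg.mul_const _).cexp).smul h1
    exact (h2.congr fun ζ' h => congrFun (hFeq ζ' h) x).differentiableAt (hUo.mem_nhds hζU)
  · set m : ℝ → ℝ := fun x => B * ‖matCLM (tailMatrix q s qm x)‖ with hm
    refine ⟨2 * e * volterraWeight m 0, c, half_pos hlp, ?_⟩
    filter_upwards [hUo.mem_nhds hζU] with ζ' h x hx
    rw [hFeq ζ' h, jostSeries, norm_smul, mul_comm]
    have hw := volterraWeight_mono (hV ζ' h).intm (hV ζ' h).m_nonneg hx
    have he0 : 0 ≤ e := by positivity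
    refine mul_le_mul (((hV ζ' h).norm_tsum_neumannTerm_le (hUs ζ' h).2.1.le x).trans ?_) ?_
      (norm_nonneg _) (mul_nonneg (by positivity) (volterraWeight_pos m 0).le)
    · exact mul_le_mul_of_nonneg_left hw (by positivity)
    · rw [Complex.norm_exp]
      refine Real.exp_le_exp.2 ?_
      have : (-(I * lam p ζ') * x).re = (lam p ζ').im * x := by simp
      rw [this]
      exact mul_le_mul_of_nonpos_right (hUs ζ' h).2.2.1.le hx

end ZakharovShabat

/-! ### Wronskian, energy and symmetries -/

section Wronskian

variable {p : Params} {q : ℝ → ℂ} {s : ℝ → ℝ} {k k' : ℂ} {f g : ℝ → Fin 2 → ℂ} {qm ζ : ℂ}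

lemma isZS_iff : IsZS q s k f ↔ ∀ x,
    HasDerivAt (fun x => f x 0) (-(I * (k + s x)) * f x 0 + q x * f x 1) x ∧
    HasDerivAt (fun x => f x 1) ((starRingEnd ℂ) (q x) * f x 0 + I * (k + s x) * f x 1) x := by
  refine forall_congr' fun x => ?_
  rw [hasDerivAt_pi, Fin.forall_fin_two]
  simp [zsMatrix, Matrix.mulVec, dotProduct, Fin.sum_univ_two]

lemma IsZS.continuous (hf : IsZS q s k f) : Continuous f :=
  continuous_iff_continuousAt.2 fun x => (hf x).continuousAt

lemma IsZS.const_smul (hf : IsZS q s k f) (c : ℂ) : IsZS q s k (fun x => c • f x) := fun x => by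
  rw [mulVec_smul]
  exact (hf x).const_smul c

lemma IsZS.sub (hf : IsZS q s k f) (hg : IsZS q s k g) : IsZS q s k (fun x => f x - g x) :=
  fun x => by
    rw [mulVec_sub]
    exact (hf x).sub (hg x)

/-- The potential and the shift are common to both systems and cancel; only the difference of the
spectral parameters survives. -/
lemma IsZS.hasDerivAt_wronskian (hf : IsZS q s k f) (hg : IsZS q s k' g) (x : ℝ) :
    HasDerivAt (fun x => wronskian (f x) (g x))
      (I * (k' - k) * (f x 0 * g x 1 + g x 0 * f x 1)) x := by
  obtain ⟨f0, f1⟩ := isZS_iff.1 hf x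
  obtain ⟨g0, g1⟩ := isZS_iff.1 hg x
  refine ((f0.mul g1).sub (g0.mul f1)).congr_deriv ?_
  ring

lemma IsZS.wronskian_const (hf : IsZS q s k f) (hg : IsZS q s k g) (x y : ℝ) :
    wronskian (f x) (g x) = wronskian (f y) (g y) := by
  have h : ∀ x, HasDerivAt (fun x => wronskian (f x) (g x)) 0 x := fun x => by
    simpa using hf.hasDerivAt_wronskian hg x
  exact is_const_of_deriv_eq_zero (fun x => (h x).differentiableAt) (fun x => (h x).deriv) x y

lemma IsZS.eq_zero (hq : Continuous q) (hs : Continuous s) (hf : IsZS q s k f) {x₀ : ℝ}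
    (h0 : f x₀ = 0) : f = 0 := by
  have hc : Continuous fun x => matCLM (zsMatrix q s k x) := by
    simp only [zsMatrix]
    simp_rw [matCLM_eq]
    have h3 : Continuous fun x => (starRingEnd ℂ) (q x) := continuous_conj.comp hq
    fun_prop
  funext x
  set a := min x x₀ - 1 with ha
  set b := max x x₀ + 1 with hb
  have h1 : a < x := by linarith [min_le_left x x₀]
  have h2 : a < x₀ := by linarith [min_le_right x x₀]
  have h3 : x < b := by linarith [le_max_left x x₀]
  have h4 : x₀ < b := by linarith [le_max_right x x₀]
  obtain ⟨K, hK⟩ := (isCompact_Icc (a := a) (b := b)).exists_bound_of_continuousOn hc.continuousOn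
  refine ODE_solution_unique_of_mem_Ioo (v := fun x y => matCLM (zsMatrix q s k x) y)
    (s := fun _ => univ) (K := K.toNNReal) (a := a) (b := b) (f := f) (g := 0) (t₀ := x₀) ?_
    ⟨h2, h4⟩ (fun x _ => ⟨by simpa using hf x, trivial⟩)
    (fun x _ => ⟨by simp, trivial⟩) h0 ⟨h1, h3⟩
  intro y hy
  refine ((matCLM (zsMatrix q s k y)).lipschitz.weaken ?_).lipschitzOnWith
  rw [← NNReal.coe_le_coe, coe_nnnorm]
  exact (hK y (Ioo_subset_Icc_self hy)).trans (Real.le_coe_toNNReal K)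

/-- Two solutions with vanishing Wronskian are proportional. -/
lemma IsZS.exists_smul_of_wronskian_eq_zero (hq : Continuous q) (hs : Continuous s)
    (hf : IsZS q s k f) (hg : IsZS q s k g) {x₀ : ℝ} (hw : wronskian (f x₀) (g x₀) = 0)
    (hg0 : g ≠ 0) : ∃ b : ℂ, ∀ x, f x = b • g x := by
  have hgx : g x₀ ≠ 0 := fun h => hg0 (hg.eq_zero hq hs h)
  obtain ⟨b, hb⟩ : ∃ b : ℂ, f x₀ = b • g x₀ := by
    rw [wronskian] at hw
    by_cases h0 : g x₀ 0 = 0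
    · have h1 : g x₀ 1 ≠ 0 := fun h1 => hgx (by ext i; fin_cases i <;> simp [h0, h1])
      have hf0 : f x₀ 0 = 0 := by simpa [h0, h1] using hw
      refine ⟨f x₀ 1 / g x₀ 1, ?_⟩
      ext i
      fin_cases i
      · simp [hf0, h0]
      · simp [h1]
    · refine ⟨f x₀ 0 / g x₀ 0, ?_⟩
      ext i
      fin_cases i
      · simp [h0]
      · simp only [Fin.mk_one, Pi.smul_apply, smul_eq_mul]
        field_simp
        linear_combination -hw
  refine ⟨b, fun x => ?_⟩
  have := (hf.sub (hg.const_smul b)).eq_zero hq hs (x₀ := x₀) (by simp [hb])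
  exact sub_eq_zero.1 (congrFun this x)

/-- The off-diagonal contributions have equal real parts, by the defocusing sign, and cancel; the
shift drops out because it is real. -/
lemma IsZS.hasDerivAt_energy (hf : IsZS q s k f) (x : ℝ) :
    HasDerivAt (fun x => ‖f x 0‖ ^ 2 - ‖f x 1‖ ^ 2)
      (2 * k.im * (‖f x 0‖ ^ 2 + ‖f x 1‖ ^ 2)) x := by
  obtain ⟨f0, f1⟩ := isZS_iff.1 hf x
  refine (f0.norm_sq.sub f1.norm_sq).congr_deriv ?_
  simp only [Complex.inner, ← normSq_eq_norm_sq, normSq_apply]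
  simp
  ring

lemma IsZS.conj_swap (hk : k.im = 0) (hf : IsZS q s k f) :
    IsZS q s k (fun x => ![(starRingEnd ℂ) (f x 1), (starRingEnd ℂ) (f x 0)]) := by
  have hk' : (starRingEnd ℂ) k = k := conj_eq_iff_im.2 hk
  refine isZS_iff.2 fun x => ?_
  obtain ⟨f0, f1⟩ := isZS_iff.1 hf x
  constructor
  · refine (f1.star).congr_deriv ?_
    simp [hk']
    ring
  · refine (f0.star).congr_deriv ?_
    simp [hk']
    ring

/-- The potential seen under the reflection `x ↦ -x` and exchange of the components. -/
noncomputable def reflectPot (q : ℝ → ℂ) (x : ℝ) : ℂ := -(starRingEnd ℂ) (q (-x))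

/-- The reflection `x ↦ -x` with exchange of the components. -/
def reflectSol (f : ℝ → Fin 2 → ℂ) (x : ℝ) : Fin 2 → ℂ := ![f (-x) 1, f (-x) 0]

lemma reflectPot_reflectPot (q : ℝ → ℂ) : reflectPot (reflectPot q) = q := by
  funext x; simp [reflectPot]

lemma reflectSol_reflectSol (f : ℝ → Fin 2 → ℂ) : reflectSol (reflectSol f) = f := by
  funext x i; fin_cases i <;> simp [reflectSol]

lemma IsZS.reflect (hf : IsZS q s k f) :
    IsZS (reflectPot q) (fun x => s (-x)) k (reflectSol f) := by
  refine isZS_iff.2 fun x => ?_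
  obtain ⟨f0, f1⟩ := isZS_iff.1 hf (-x)
  constructor
  · refine (f1.scomp x (hasDerivAt_neg x)).congr_deriv ?_
    simp [reflectPot, reflectSol]
    ring
  · refine (f0.scomp x (hasDerivAt_neg x)).congr_deriv ?_
    simp [reflectPot, reflectSol]
    ring

lemma isZS_reflect_iff :
    IsZS (reflectPot q) (fun x => s (-x)) k (reflectSol f) ↔ IsZS q s k f := by
  refine ⟨fun h => ?_, IsZS.reflect⟩
  have := h.reflect
  simpa only [reflectPot_reflectPot, reflectSol_reflectSol, neg_neg] using this

lemma norm_wronskian_le (v w : Fin 2 → ℂ) : ‖wronskian v w‖ ≤ 2 * ‖v‖ * ‖w‖ := by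
  have h0 := norm_le_pi_norm v 0
  have h1 := norm_le_pi_norm v 1
  have h2 := norm_le_pi_norm w 0
  have h3 := norm_le_pi_norm w 1
  rw [wronskian]
  refine (norm_sub_le _ _).trans ?_
  rw [norm_mul, norm_mul]
  have := mul_le_mul h0 h3 (norm_nonneg _) (norm_nonneg _)
  have := mul_le_mul h2 h1 (norm_nonneg _) (norm_nonneg _)
  linarith

lemma norm_mixed_le (v w : Fin 2 → ℂ) : ‖v 0 * w 1 + w 0 * v 1‖ ≤ 2 * ‖v‖ * ‖w‖ := by
  have h0 := norm_le_pi_norm v 0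
  have h1 := norm_le_pi_norm v 1
  have h2 := norm_le_pi_norm w 0
  have h3 := norm_le_pi_norm w 1
  refine (norm_add_le _ _).trans ?_
  rw [norm_mul, norm_mul]
  have := mul_le_mul h0 h3 (norm_nonneg _) (norm_nonneg _)
  have := mul_le_mul h2 h1 (norm_nonneg _) (norm_nonneg _)
  linarith

lemma integrableOn_exp_mul_Iic_zero {c : ℝ} (hc : 0 < c) (C : ℝ) :
    IntegrableOn (fun x => C * Real.exp (c * x)) (Iic 0) :=
  (integrableOn_exp_mul_Iic hc 0).const_mul C

lemma tendsto_exp_mul_atBot {c : ℝ} (hc : 0 < c) (C : ℝ) :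
    Tendsto (fun x => C * Real.exp (c * x)) atBot (𝓝 0) := by
  have h : Tendsto (fun x : ℝ => c * x) atBot atBot := tendsto_id.const_mul_atBot hc
  simpa using (Real.tendsto_exp_atBot.comp h).const_mul C

lemma hasDerivAt_kappa (p : Params) (hζ : ζ ≠ 0) :
    HasDerivAt (kappa p) ((1 - p.q₀ ^ 2 * (ζ ^ 2)⁻¹) / 2) ζ := by
  have h := ((hasDerivAt_id ζ).add ((hasDerivAt_inv hζ).const_mul ((p.q₀ : ℂ) ^ 2))).div_const 2
  refine h.congr_deriv ?_
  ring

/-- The Wronskian of the `ζ`-derivative of the Jost solution with the Jost solution. -/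
lemma IsTail.wronskian_deriv (hT : IsTail p q s qm) {F : ℂ → ℝ → Fin 2 → ℂ}
    (hF : ∀ ζ, 0 < ζ.im → IsJost p q s qm ζ (F ζ)) (hζ : 0 < ζ.im) :
    wronskian (deriv (fun ζ => F ζ 0) ζ) (F ζ 0) =
      -(I * (1 - p.q₀ ^ 2 * (ζ ^ 2)⁻¹)) * ∫ x in Iic 0, F ζ x 0 * F ζ x 1 := by
  obtain ⟨hd, C, c, hc, hb⟩ := hT.exists_local hF hζ
  have hζ0 : ζ ≠ 0 := (mem_scatDomain_of_im_pos p hζ).2.1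
  set J : ℂ → ℝ → ℂ := fun ζ' x => F ζ' x 0 * F ζ x 1 + F ζ x 0 * F ζ' x 1 with hJ
  have hev : ∀ᶠ ζ' in 𝓝 ζ, 0 < ζ'.im := isOpen_upper.mem_nhds hζ
  have hb0 := hb.self_of_nhds
  have hC0 : 0 ≤ C := by
    have := (norm_nonneg _).trans (hb0 0 le_rfl)
    simpa using this
  have hcont : ∀ ζ', 0 < ζ'.im → Continuous (F ζ') := fun ζ' h => (hF ζ' h).1.continuous
  have hJc : ∀ ζ', 0 < ζ'.im → Continuous (J ζ') := fun ζ' h => by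
    have h1 := hcont ζ' h
    have h2 := hcont ζ hζ
    fun_prop
  have hbi := integrableOn_exp_mul_Iic_zero (c := c + c) (by linarith) (2 * C * C)
  have hexp : ∀ ζ', (∀ x ≤ 0, ‖F ζ' x‖ ≤ C * Real.exp (c * x)) → ∀ x ≤ 0,
      2 * ‖F ζ' x‖ * ‖F ζ x‖ ≤ 2 * C * C * Real.exp ((c + c) * x) := fun ζ' h x hx => by
    have h1 : 2 * C * C * Real.exp ((c + c) * x) =
        2 * (C * Real.exp (c * x)) * (C * Real.exp (c * x)) := by
      rw [add_mul, Real.exp_add]; ring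
    rw [h1]
    have := h x hx
    have := hb0 x hx
    gcongr
  have hJb : ∀ ζ', (∀ x ≤ 0, ‖F ζ' x‖ ≤ C * Real.exp (c * x)) → ∀ x ≤ 0,
      ‖J ζ' x‖ ≤ 2 * C * C * Real.exp ((c + c) * x) := fun ζ' h x hx =>
    (norm_mixed_le _ _).trans (hexp ζ' h x hx)
  have hJi : ∀ ζ', 0 < ζ'.im → (∀ x ≤ 0, ‖F ζ' x‖ ≤ C * Real.exp (c * x)) →
      IntegrableOn (J ζ') (Iic 0) := fun ζ' h h' => by
    refine hbi.mono' (hJc ζ' h).aestronglyMeasurable ?_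
    filter_upwards [ae_restrict_mem measurableSet_Iic] with x hx using hJb ζ' h' x hx
  have hJt : Tendsto (fun ζ' => ∫ x in Iic 0, J ζ' x) (𝓝 ζ) (𝓝 (∫ x in Iic 0, J ζ x)) := by
    refine tendsto_integral_filter_of_dominated_convergence _ ?_ ?_ hbi ?_
    · filter_upwards [hev] with ζ' h using (hJc ζ' h).aestronglyMeasurable
    · filter_upwards [hb] with ζ' h
      filter_upwards [ae_restrict_mem measurableSet_Iic] with x hx using hJb ζ' h x hx
    · refine ae_of_all _ fun x => ?_
      have h1 : Tendsto (fun ζ' => F ζ' x) (𝓝 ζ) (𝓝 (F ζ x)) := (hd x).continuousAt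
      have h2 := tendsto_pi_nhds.1 h1
      exact ((h2 0).mul_const _).add ((h2 1).const_mul _)
  -- The Wronskian is recovered by integrating its x-derivative from -∞, where both solutions decay.
  have hW : ∀ᶠ ζ' in 𝓝 ζ, wronskian (F ζ' 0) (F ζ 0) =
      (kappa p ζ' - kappa p ζ) * (-I * ∫ x in Iic 0, J ζ' x) := by
    filter_upwards [hev, hb] with ζ' h h'
    have h1 := integral_Iic_of_hasDerivAt_of_tendsto' (a := 0)
      (fun x _ => (hF ζ' h).1.hasDerivAt_wronskian (hF ζ hζ).1 x)
      ((hJi ζ' h h').const_mul _) (m := 0) ?_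
    · rw [integral_const_mul, sub_zero] at h1
      rw [← h1]; ring
    · rw [tendsto_zero_iff_norm_tendsto_zero]
      refine squeeze_zero' (.of_forall fun _ => norm_nonneg _) ?_
        (tendsto_exp_mul_atBot (c := c + c) (by linarith) (2 * C * C))
      filter_upwards [eventually_le_atBot 0] with x hx
      exact (norm_wronskian_le _ _).trans (hexp ζ' h' x hx)
  have hD := hasDerivAt_pi.1 (hd 0).hasDerivAt
  have h1 : HasDerivAt (fun ζ' => wronskian (F ζ' 0) (F ζ 0))
      (wronskian (deriv (fun ζ => F ζ 0) ζ) (F ζ 0)) ζ :=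
    (((hD 0).mul_const _).sub ((hD 1).const_mul _)).congr_deriv (by rw [wronskian])
  -- The first factor vanishes at ζ, so mere continuity of the integral in ζ' suffices to
  -- differentiate the product there.
  have h2 : HasDerivAt (fun ζ' => (kappa p ζ' - kappa p ζ) * (-I * ∫ x in Iic 0, J ζ' x))
      ((1 - p.q₀ ^ 2 * (ζ ^ 2)⁻¹) / 2 * (-I * ∫ x in Iic 0, J ζ x)) ζ := by
    rw [hasDerivAt_iff_tendsto_slope]
    have h3 := (hasDerivAt_iff_tendsto_slope.1 (hasDerivAt_kappa p hζ0)).mul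
      ((hJt.mono_left nhdsWithin_le_nhds).const_mul (-I))
    refine h3.congr fun ζ' => ?_
    simp only [slope_def_field, sub_self, zero_mul, sub_zero]
    ring
  have h4 := h1.unique (h2.congr_of_eventuallyEq hW)
  have h5 : ∀ x, J ζ x = 2 * (F ζ x 0 * F ζ x 1) := fun x => by simp only [hJ]; ring
  rw [h4]
  simp only [h5]
  rw [integral_const_mul]
  ring

end Wronskian

/-! ### The Kundu-Eckhaus scattering problem as a Zakharov-Shabat system -/

section Scattering

variable {p : Params} {q : ℝ → ℂ} {s : ℝ → ℝ} {k : ℂ} {f : ℝ → Fin 2 → ℂ} {qm ζ : ℂ}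
  {u : ℝ → ℝ → ℂ} {t : ℝ}

lemma im_kappa (p : Params) (ζ : ℂ) : (kappa p ζ).im = ζ.im * (1 - p.q₀ ^ 2 / normSq ζ) / 2 := by
  have : ((p.q₀ : ℂ) ^ 2 * ζ⁻¹).im = p.q₀ ^ 2 * (-ζ.im / normSq ζ) := by
    rw [← ofReal_pow, im_ofReal_mul, inv_im]
  have h2 : kappa p ζ = ((1 / 2 : ℝ) : ℂ) * (ζ + p.q₀ ^ 2 * ζ⁻¹) := by
    rw [kappa]; push_cast; ring
  rw [h2, im_ofReal_mul, add_im, this]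
  ring

lemma one_sub_ne_zero_of_mem (hζ : ζ ∈ scatDomain p) : 1 - (p.q₀ : ℂ) ^ 2 * (ζ ^ 2)⁻¹ ≠ 0 := by
  obtain ⟨-, h0, h1, h2⟩ := hζ
  have h : 1 - (p.q₀ : ℂ) ^ 2 * (ζ ^ 2)⁻¹ = 2 * lam p ζ * ζ⁻¹ := by
    rw [lam]; field_simp
  rw [h]
  exact mul_ne_zero (mul_ne_zero two_ne_zero (lam_ne_zero h0 h1 h2)) (inv_ne_zero h0)

/-- The shift `T (|q|² - q₀²)` of the spectral parameter. -/
noncomputable def ampShift (p : Params) (q : ℝ → ℂ) (x : ℝ) : ℝ := p.T * (‖q x‖ ^ 2 - p.q₀ ^ 2)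

/-- Factoring |q|² - q₀² as (|q| + q₀)(|q| - |qm|), with the first factor bounded towards -∞, makes
integrability of q - qm enough for the shift. -/
lemma isTail_ampShift (hq : Continuous q) (hqm : ‖qm‖ = p.q₀) (hl : Tendsto q atBot (𝓝 qm))
    (hi : IntegrableOn (fun x => q x - qm) (Iic 0)) : IsTail p q (ampShift p q) qm where
  contq := hq
  conts := by unfold ampShift; fun_prop
  intq := hi
  norm_qm := hqm
  ints := by
    obtain ⟨C, hC⟩ := exists_norm_le_of_tendsto_atBot hq hl 0
    refine Integrable.mono' (hi.norm.const_mul (|p.T| * (C + p.q₀)))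
      (by unfold ampShift; fun_prop) ?_
    filter_upwards [ae_restrict_mem measurableSet_Iic] with x hx
    have h1 : ampShift p q x = p.T * (‖q x‖ + p.q₀) * (‖q x‖ - ‖qm‖) := by
      rw [ampShift, hqm]; ring
    rw [h1, norm_mul, norm_mul, Real.norm_eq_abs, Real.norm_eq_abs, Real.norm_eq_abs,
      abs_of_nonneg (add_nonneg (norm_nonneg _) p.q₀_pos.le)]
    have h2 := hC x hx
    have h3 := abs_norm_sub_norm_le (q x) qm
    have hC0 : 0 ≤ C + p.q₀ := add_nonneg ((norm_nonneg _).trans h2) p.q₀_pos.le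
    gcongr

lemma norm_qInf (p : Params) (θ : ℝ) : ‖qInf p θ‖ = p.q₀ := by
  rw [qInf, norm_mul, mul_comm I, norm_exp_ofReal_mul_I, mul_one, norm_real,
    Real.norm_of_nonneg p.q₀_pos.le]

lemma potential_sub_qInf (p : Params) (u : ℝ → ℝ → ℂ) (θ x t : ℝ) :
    potential p u x t - qInf p θ =
      exp (-(I * (phase p x t : ℂ))) * (u x t - planeWave p θ x t) := by
  have h : qInf p θ = exp (-(I * (phase p x t : ℂ))) * planeWave p θ x t := by
    rw [qInf, planeWave, mul_left_comm, ← Complex.exp_add]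
    congr 2
    push_cast; ring
  rw [potential, h]; ring

lemma norm_potential_sub_qInf (p : Params) (u : ℝ → ℝ → ℂ) (θ x t : ℝ) :
    ‖potential p u x t - qInf p θ‖ = ‖u x t - planeWave p θ x t‖ := by
  rw [potential_sub_qInf, norm_mul, ← mul_neg, ← ofReal_neg, mul_comm I, norm_exp_ofReal_mul_I,
    one_mul]

namespace NonzeroBoundary

variable (hu : NonzeroBoundary p u t)

include hu

lemma continuous_potential : Continuous fun x => potential p u x t := by
  have := hu.continuous
  unfold potential phase
  fun_prop

omit hu in
lemma tendsto_potential {θ : ℝ} {l : Filter ℝ}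
    (h : Tendsto (fun x => u x t - planeWave p θ x t) l (𝓝 0)) :
    Tendsto (fun x => potential p u x t) l (𝓝 (qInf p θ)) := by
  rw [tendsto_iff_norm_sub_tendsto_zero]
  simp only [norm_potential_sub_qInf]
  simpa using h.norm

lemma integrableOn_potential {θ : ℝ} {S : Set ℝ}
    (h : IntegrableOn (fun x => u x t - planeWave p θ x t) S) :
    IntegrableOn (fun x => potential p u x t - qInf p θ) S := by
  refine Integrable.congr' h
    (hu.continuous_potential.sub continuous_const).aestronglyMeasurable (ae_of_all _ fun x => ?_)
  exact (norm_potential_sub_qInf p u θ x t).symm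

lemma isTail_minus :
    IsTail p (fun x => potential p u x t) (ampShift p fun x => potential p u x t)
      (qInf p p.θm) :=
  isTail_ampShift hu.continuous_potential (norm_qInf _ _) (tendsto_potential hu.tendsto_bot)
    (hu.integrableOn_potential hu.integrable_bot)

/-- The boundary condition at +∞ becomes one at -∞ after reflection, with limiting value -conj q₊.
-/
lemma isTail_plus :
    IsTail p (reflectPot fun x => potential p u x t)
      (fun x => ampShift p (fun x => potential p u x t) (-x))
      (-(starRingEnd ℂ) (qInf p p.θp)) := by
  have h : (fun x => ampShift p (fun x => potential p u x t) (-x)) =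
      ampShift p (reflectPot fun x => potential p u x t) := by
    funext x; simp [ampShift, reflectPot]
  rw [h]
  refine isTail_ampShift (continuous_conj.comp (hu.continuous_potential.comp continuous_neg)).neg
    (by simpa using norm_qInf p p.θp) ?_ ?_
  · have h1 := (tendsto_potential hu.tendsto_top).comp tendsto_neg_atBot_atTop
    exact ((continuous_conj.tendsto _).comp h1).neg
  · have h1 : IntegrableOn (fun x => potential p u x t - qInf p p.θp) (Ici (-0)) := by
      rw [neg_zero]; exact hu.integrableOn_potential hu.integrable_top
    have h2 := ((conjCLE : ℂ →L[ℝ] ℂ).integrable_comp h1.comp_neg_Iic).neg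
    refine Integrable.congr h2 (ae_of_all _ fun x => ?_)
    simp [reflectPot]
    ring

end NonzeroBoundary

/-- The time-dependent part `e^{i (Θ(x, t, ζ) - lam x)}` of the exponential `e^{iΘ}`. -/
noncomputable def timeFactor (p : Params) (t : ℝ) (ζ : ℂ) : ℂ :=
  exp (I * lam p ζ * (2 * (specZ p ζ - p.T * p.q₀ ^ 2 - p.α / 2) * t))

lemma timeFactor_ne_zero (p : Params) (t : ℝ) (ζ : ℂ) : timeFactor p t ζ ≠ 0 := exp_ne_zero _

lemma exp_Theta (p : Params) (x t : ℝ) (ζ : ℂ) :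
    exp (I * Theta p x t ζ) = exp (I * lam p ζ * x) * timeFactor p t ζ := by
  rw [timeFactor, ← Complex.exp_add, Theta]
  congr 1; ring

lemma laxX_eq (p : Params) (u : ℝ → ℝ → ℂ) (x t : ℝ) (ζ : ℂ) :
    laxX p u x t ζ = zsMatrix (fun x => potential p u x t)
      (ampShift p fun x => potential p u x t) (kappa p ζ) x := by
  ext i j
  fin_cases i <;> fin_cases j <;> simp [laxX, zsMatrix, specZ, ampShift] <;> ring

lemma isZS_smul_iff {c : ℂ} (hc : c ≠ 0) : IsZS q s k (fun x => c • f x) ↔ IsZS q s k f := by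
  refine ⟨fun h => ?_, fun h => h.const_smul c⟩
  simpa [smul_smul, hc] using h.const_smul c⁻¹

lemma isJostMinusOne_iff : IsJostMinusOne p u t ζ f ↔
    IsJost p (fun x => potential p u x t) (ampShift p fun x => potential p u x t) (qInf p p.θm) ζ
      (fun x => timeFactor p t ζ • f x) := by
  refine and_congr ?_ ?_
  · rw [isZS_smul_iff (timeFactor_ne_zero p t ζ), IsZS]
    simp only [laxX_eq]
  · have h : (fun i => eigMatrix p p.θm ζ i 0) = jostLimit (qInf p p.θm) ζ := by
      funext i; fin_cases i <;> simp [eigMatrix, jostLimit]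
    rw [h]
    simp only [exp_Theta, smul_smul]

/-- Reflection turns e^{-iλx} into e^{iλx} and the second column of E₊ into the `jostLimit` of -conj
q₊; the time factor is inverted because the exponent is -iΘ. -/
lemma isJostPlusTwo_iff : IsJostPlusTwo p u t ζ f ↔
    IsJost p (reflectPot fun x => potential p u x t)
      (fun x => ampShift p (fun x => potential p u x t) (-x)) (-(starRingEnd ℂ) (qInf p p.θp)) ζ
      (fun x => (timeFactor p t ζ)⁻¹ • reflectSol f x) := by
  refine and_congr ?_ ?_
  · rw [isZS_smul_iff (inv_ne_zero (timeFactor_ne_zero p t ζ)), isZS_reflect_iff, IsZS]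
    simp only [laxX_eq]
  · have h : ∀ x : ℝ, exp (-(I * Theta p x t ζ)) =
        exp (I * lam p ζ * ((-x : ℝ) : ℂ)) * (timeFactor p t ζ)⁻¹ := fun x => by
      rw [Complex.exp_neg, exp_Theta, mul_inv, ← Complex.exp_neg]
      push_cast; ring_nf
    simp only [h, tendsto_pi_nhds, Fin.forall_fin_two, smul_smul]
    simp only [eigMatrix, jostLimit, reflectSol, Pi.smul_apply]
    simp only [of_apply, cons_val_zero, cons_val_one, map_neg, conj_conj]
    rw [and_comm]
    refine and_congr ⟨fun h => ?_, fun h => ?_⟩ ⟨fun h => ?_, fun h => ?_⟩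
    · simpa [Function.comp_def] using h.comp tendsto_neg_atBot_atTop
    · simpa [Function.comp_def] using h.comp tendsto_neg_atTop_atBot
    · simpa [Function.comp_def] using h.comp tendsto_neg_atBot_atTop
    · simpa [Function.comp_def] using h.comp tendsto_neg_atTop_atBot

namespace NonzeroBoundary

variable (hu : NonzeroBoundary p u t)

include hu

lemma existsUnique_jostMinusOne (hζ : ζ ∈ scatDomain p) : ∃! f, IsJostMinusOne p u t ζ f := by
  have hc := timeFactor_ne_zero p t ζ
  refine ⟨fun x => (timeFactor p t ζ)⁻¹ • jostSeries p (fun x => potential p u x t)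
    (ampShift p fun x => potential p u x t) (qInf p p.θm) ζ x, ?_, fun g hg => ?_⟩
  · simp only [isJostMinusOne_iff, smul_smul, mul_inv_cancel₀ hc, one_smul]
    exact hu.isTail_minus.isJost_jostSeries hζ
  · have := IsJost.unique hu.isTail_minus hζ (isJostMinusOne_iff.1 hg)
      (hu.isTail_minus.isJost_jostSeries hζ)
    rw [← this]
    simp [smul_smul, hc]

lemma existsUnique_jostPlusTwo (hζ : ζ ∈ scatDomain p) : ∃! f, IsJostPlusTwo p u t ζ f := by
  have hc := timeFactor_ne_zero p t ζ
  set G := jostSeries p (reflectPot fun x => potential p u x t)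
    (fun x => ampShift p (fun x => potential p u x t) (-x)) (-(starRingEnd ℂ) (qInf p p.θp)) ζ
  have hsmul : ∀ (c : ℂ) (f : ℝ → Fin 2 → ℂ) (x : ℝ),
      reflectSol (fun x => c • f x) x = c • reflectSol f x := fun c f x => by
    ext i; fin_cases i <;> simp [reflectSol]
  refine ⟨fun x => timeFactor p t ζ • reflectSol G x, ?_, fun g hg => ?_⟩
  · simp only [isJostPlusTwo_iff, hsmul, smul_smul, inv_mul_cancel₀ hc, one_smul]
    change IsJost _ _ _ _ _ (reflectSol (reflectSol G))
    rw [reflectSol_reflectSol]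
    exact hu.isTail_plus.isJost_jostSeries hζ
  · have : (fun x => (timeFactor p t ζ)⁻¹ • reflectSol g x) = G :=
      IsJost.unique hu.isTail_plus hζ (isJostPlusTwo_iff.1 hg)
        (hu.isTail_plus.isJost_jostSeries hζ)
    rw [← this]
    funext x
    rw [hsmul, smul_smul, mul_inv_cancel₀ hc, one_smul, reflectSol_reflectSol]

lemma isJostMinusOne_psi (hζ : ζ ∈ scatDomain p) :
    IsJostMinusOne p u t ζ (psiMinusOne p u t ζ) :=
  Classical.epsilon_spec (hu.existsUnique_jostMinusOne hζ).exists

lemma isJostPlusTwo_psi (hζ : ζ ∈ scatDomain p) :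
    IsJostPlusTwo p u t ζ (psiPlusTwo p u t ζ) :=
  Classical.epsilon_spec (hu.existsUnique_jostPlusTwo hζ).exists

end NonzeroBoundary

lemma IsJost.ne_zero (hf : IsJost p q s qm ζ f) : f ≠ 0 := by
  rintro rfl
  have h1 := tendsto_nhds_unique hf.2 (by simp : Tendsto _ _ (𝓝 (0 : Fin 2 → ℂ)))
  have := congrFun h1 0
  simp [jostLimit] at this

/-- For real `ζ` the Jost solution has constant energy `1 - q₀² / |ζ|²`. -/
lemma IsJost.energy_eq (hf : IsJost p q s qm ζ f) (hqm : ‖qm‖ = p.q₀) (hζ : ζ.im = 0) (x : ℝ) :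
    ‖f x 0‖ ^ 2 - ‖f x 1‖ ^ 2 = 1 - p.q₀ ^ 2 / ‖ζ‖ ^ 2 := by
  have hd : ∀ x, HasDerivAt (fun x => ‖f x 0‖ ^ 2 - ‖f x 1‖ ^ 2) 0 x := fun x => by
    simpa [im_kappa, hζ] using hf.1.hasDerivAt_energy x
  have hconst : ∀ y, ‖f y 0‖ ^ 2 - ‖f y 1‖ ^ 2 = ‖f x 0‖ ^ 2 - ‖f x 1‖ ^ 2 := fun y =>
    is_const_of_deriv_eq_zero (fun x => (hd x).differentiableAt) (fun x => (hd x).deriv) y x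
  have hl := tendsto_pi_nhds.1 hf.2
  have h1 := ((hl 0).norm.pow 2).sub ((hl 1).norm.pow 2)
  have hexp : ∀ y : ℝ, ‖exp (I * lam p ζ * y)‖ = 1 := fun y => by
    rw [Complex.norm_exp]
    simp [im_lam, hζ]
  simp only [Pi.smul_apply, norm_smul, hexp, one_mul, hconst] at h1
  have h2 := tendsto_nhds_unique h1 tendsto_const_nhds
  rw [← h2]
  simp [jostLimit, hqm, mul_pow, div_eq_mul_inv]

lemma integrable_of_exp_decay {f : ℝ → Fin 2 → ℂ} (hf : Continuous f) {C₁ c₁ C₂ c₂ : ℝ}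
    (hc₁ : 0 < c₁) (hc₂ : 0 < c₂) (h₁ : ∀ x ≤ 0, ‖f x‖ ≤ C₁ * Real.exp (c₁ * x))
    (h₂ : ∀ x ≤ 0, ‖f (-x)‖ ≤ C₂ * Real.exp (c₂ * x)) :
    Integrable (fun x => ‖f x‖ ^ 2) ∧ Tendsto f atBot (𝓝 0) ∧ Tendsto f atTop (𝓝 0) := by
  have aux : ∀ {g : ℝ → Fin 2 → ℂ} {C c : ℝ}, Continuous g → 0 < c →
      (∀ x ≤ 0, ‖g x‖ ≤ C * Real.exp (c * x)) →
      IntegrableOn (fun x => ‖g x‖ ^ 2) (Iic 0) ∧ Tendsto g atBot (𝓝 0) := by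
    intro g C c hg hc h
    constructor
    · refine (integrableOn_exp_mul_Iic_zero (c := c + c) (by linarith) (C * C)).mono'
        (by fun_prop) ?_
      filter_upwards [ae_restrict_mem measurableSet_Iic] with x hx
      have h1 : C * C * Real.exp ((c + c) * x) = (C * Real.exp (c * x)) ^ 2 := by
        rw [add_mul, Real.exp_add]; ring
      rw [h1, norm_pow, norm_norm]
      exact pow_le_pow_left₀ (norm_nonneg _) (h x hx) 2
    · rw [tendsto_zero_iff_norm_tendsto_zero]
      refine squeeze_zero' (.of_forall fun _ => norm_nonneg _) ?_ (tendsto_exp_mul_atBot hc C)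
      filter_upwards [eventually_le_atBot 0] with x hx using h x hx
  obtain ⟨a1, a2⟩ := aux hf hc₁ h₁
  obtain ⟨b1, b2⟩ := aux (hf.comp continuous_neg) hc₂ h₂
  refine ⟨?_, a2, ?_⟩
  · have b3 : IntegrableOn (fun x => ‖f x‖ ^ 2) (Ici 0) := by
      have : IntegrableOn (fun x => ‖f (-x)‖ ^ 2) (Iic (-0)) := by rw [neg_zero]; exact b1
      simpa using this.comp_neg_Ici
    rw [← integrableOn_univ, ← Iic_union_Ici (a := (0 : ℝ))]
    exact a1.union b3
  · have := b2.comp tendsto_neg_atTop_atBot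
    simpa [Function.comp_def] using this

/-- The Zakharov-Shabat system is formally self-adjoint: eigenvalues with square integrable
eigenfunctions are real. -/
lemma IsZS.im_eq_zero (hf : IsZS q s k f) (hf0 : f ≠ 0) (hi : Integrable fun x => ‖f x‖ ^ 2)
    (hbot : Tendsto f atBot (𝓝 0)) (htop : Tendsto f atTop (𝓝 0)) : k.im = 0 := by
  have hc := hf.continuous
  have hci : ∀ i, Integrable fun x => ‖f x i‖ ^ 2 := fun i => by
    refine hi.mono' (by fun_prop) (ae_of_all _ fun x => ?_)
    rw [norm_pow, norm_norm]
    exact pow_le_pow_left₀ (norm_nonneg _) (norm_le_pi_norm _ _) 2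
  have hlim : ∀ {l : Filter ℝ}, Tendsto f l (𝓝 0) →
      Tendsto (fun x => ‖f x 0‖ ^ 2 - ‖f x 1‖ ^ 2) l (𝓝 0) := fun h => by
    have h1 := tendsto_pi_nhds.1 h
    simpa using ((h1 0).norm.pow 2).sub ((h1 1).norm.pow 2)
  have hi2 : Integrable fun x => ‖f x 0‖ ^ 2 + ‖f x 1‖ ^ 2 := (hci 0).add (hci 1)
  have h := integral_of_hasDerivAt_of_tendsto (fun x => hf.hasDerivAt_energy x)
    (hi2.const_mul (2 * k.im)) (hlim hbot) (hlim htop)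
  rw [integral_const_mul, sub_zero] at h
  rcases mul_eq_zero.1 h with h | h
  · linarith
  · exfalso
    rw [integral_eq_zero_iff_of_nonneg (fun x => by positivity) hi2] at h
    replace h := (Continuous.ae_eq_iff_eq volume (by fun_prop) continuous_zero).1 h
    refine hf0 (funext fun x => ?_)
    have h1 : ‖f x 0‖ ^ 2 + ‖f x 1‖ ^ 2 = 0 := congrFun h x
    have h2 : ‖f x 0‖ = 0 := by nlinarith [sq_nonneg ‖f x 0‖, sq_nonneg ‖f x 1‖]
    have h3 : ‖f x 1‖ = 0 := by nlinarith [sq_nonneg ‖f x 0‖, sq_nonneg ‖f x 1‖]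
    ext i
    fin_cases i
    · simpa using h2
    · simpa using h3

/-- On the circle `|ζ| = q₀` the components of the Jost solution are related by conjugation. -/
lemma IsJost.conj_symm (hT : IsTail p q s qm) (hζ : ζ ∈ scatDomain p) (hn : ‖ζ‖ = p.q₀)
    (hf : IsJost p q s qm ζ f) (x : ℝ) :
    f x 1 = I * (starRingEnd ℂ) qm * ζ⁻¹ * (starRingEnd ℂ) (f x 0) := by
  have h0 := hζ.2.1
  have hq0 := p.q₀_pos
  have hinv : (p.q₀ : ℂ) ^ 2 * ζ⁻¹ = (starRingEnd ℂ) ζ := by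
    have : (p.q₀ : ℂ) ^ 2 = (starRingEnd ℂ) ζ * ζ := by
      rw [mul_comm, Complex.mul_conj, normSq_eq_norm_sq, hn]; push_cast; rfl
    rw [this, mul_assoc, mul_inv_cancel₀ h0, mul_one]
  have hk : (kappa p ζ).im = 0 := by
    rw [im_kappa, normSq_eq_norm_sq, hn, div_self (by positivity)]; simp
  have hl : (starRingEnd ℂ) (I * lam p ζ) = I * lam p ζ := by
    rw [lam, hinv]; simp [Complex.conj_ofNat]; ring
  have hcc := hT.conj_mul
  -- On the circle κ and iλ are real, so conjugation with exchange of components preserves both the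
  -- system and the exponential. The constant restores the normalization at -∞, and uniqueness then
  -- gives the relation.
  have hg : IsJost p q s qm ζ fun x => (I * (starRingEnd ℂ) qm * ζ⁻¹) •
      ![(starRingEnd ℂ) (f x 1), (starRingEnd ℂ) (f x 0)] := by
    refine ⟨(hf.1.conj_swap hk).const_smul _, ?_⟩
    have hlim := tendsto_pi_nhds.1 hf.2
    have hexp : ∀ x : ℝ, (starRingEnd ℂ) (exp (I * lam p ζ * x)) = exp (I * lam p ζ * x) :=
      fun x => by rw [← Complex.exp_conj, map_mul, hl, conj_ofReal]
    have h1 := (((continuous_conj.tendsto _).comp (hlim 1)).const_mul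
      (I * (starRingEnd ℂ) qm * ζ⁻¹))
    have h2 := (((continuous_conj.tendsto _).comp (hlim 0)).const_mul
      (I * (starRingEnd ℂ) qm * ζ⁻¹))
    simp only [Function.comp_def, Pi.smul_apply, smul_eq_mul, map_mul, hexp] at h1 h2
    rw [tendsto_pi_nhds, Fin.forall_fin_two]
    constructor
    · have h3 : I * (starRingEnd ℂ) qm * ζ⁻¹ * (starRingEnd ℂ) (jostLimit qm ζ 1) = 1 := by
        have h4 : ((p.q₀ : ℂ) ^ 2) * ζ⁻¹ * ((starRingEnd ℂ) ζ)⁻¹ = 1 := by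
          rw [hinv, mul_inv_cancel₀ (by simpa using h0)]
        simp [jostLimit]
        linear_combination h4 + hcc * ζ⁻¹ * ((starRingEnd ℂ) ζ)⁻¹ -
          ((starRingEnd ℂ) qm * qm * ζ⁻¹ * ((starRingEnd ℂ) ζ)⁻¹) * I_mul_I
      rw [h3] at h1
      refine h1.congr fun x => ?_
      simp
      ring
    · have h3 : I * (starRingEnd ℂ) qm * ζ⁻¹ * (starRingEnd ℂ) (jostLimit qm ζ 0) =
          jostLimit qm ζ 1 := by simp [jostLimit]
      rw [h3] at h2
      refine h2.congr fun x => ?_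
      simp
      ring
  have := congrFun (IsJost.unique hT hζ hf hg) x
  simpa using congrFun this 1

end Scattering

/-! ### Analyticity of `a` and its zeros -/

section Zeros

variable {p : Params} {u : ℝ → ℝ → ℂ} {t : ℝ} {ζ : ℂ}

/-- The Jost solution `ψ₋₁`, normalized without the time factor. -/
noncomputable def jostMinus (p : Params) (u : ℝ → ℝ → ℂ) (t : ℝ) (ζ : ℂ) (x : ℝ) : Fin 2 → ℂ :=
  timeFactor p t ζ • psiMinusOne p u t ζ x

/-- The Jost solution `ψ₊₂`, reflected and normalized without the time factor. -/
noncomputable def jostPlus (p : Params) (u : ℝ → ℝ → ℂ) (t : ℝ) (ζ : ℂ) (x : ℝ) : Fin 2 → ℂ :=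
  (timeFactor p t ζ)⁻¹ • reflectSol (psiPlusTwo p u t ζ) x

lemma wronskian_psi_zero (p : Params) (u : ℝ → ℝ → ℂ) (t : ℝ) (ζ : ℂ) :
    wronskian (psiMinusOne p u t ζ 0) (psiPlusTwo p u t ζ 0) =
      jostMinus p u t ζ 0 0 * jostPlus p u t ζ 0 0 -
        jostPlus p u t ζ 0 1 * jostMinus p u t ζ 0 1 := by
  have hc := timeFactor_ne_zero p t ζ
  simp only [wronskian, jostMinus, jostPlus, reflectSol, Pi.smul_apply, smul_eq_mul, neg_zero,
    cons_val_zero, cons_val_one]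
  field_simp

namespace NonzeroBoundary

variable (hu : NonzeroBoundary p u t)

include hu

lemma isJost_jostMinus (hζ : ζ ∈ scatDomain p) :
    IsJost p (fun x => potential p u x t) (ampShift p fun x => potential p u x t) (qInf p p.θm) ζ
      (jostMinus p u t ζ) :=
  isJostMinusOne_iff.1 (hu.isJostMinusOne_psi hζ)

lemma isJost_jostPlus (hζ : ζ ∈ scatDomain p) :
    IsJost p (reflectPot fun x => potential p u x t)
      (fun x => ampShift p (fun x => potential p u x t) (-x)) (-(starRingEnd ℂ) (qInf p p.θp)) ζ
      (jostPlus p u t ζ) :=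
  isJostPlusTwo_iff.1 (hu.isJostPlusTwo_psi hζ)

lemma isZS_psiMinusOne (hζ : ζ ∈ scatDomain p) :
    IsZS (fun x => potential p u x t) (ampShift p fun x => potential p u x t) (kappa p ζ)
      (psiMinusOne p u t ζ) :=
  (isZS_smul_iff (timeFactor_ne_zero p t ζ)).1 (hu.isJost_jostMinus hζ).1

lemma isZS_psiPlusTwo (hζ : ζ ∈ scatDomain p) :
    IsZS (fun x => potential p u x t) (ampShift p fun x => potential p u x t) (kappa p ζ)
      (psiPlusTwo p u t ζ) :=
  isZS_reflect_iff.1 <|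
    (isZS_smul_iff (inv_ne_zero (timeFactor_ne_zero p t ζ))).1 (hu.isJost_jostPlus hζ).1

lemma psiMinusOne_ne_zero (hζ : ζ ∈ scatDomain p) : psiMinusOne p u t ζ ≠ 0 := fun h =>
  (hu.isJost_jostMinus hζ).ne_zero (by funext x; simp [jostMinus, h])

lemma psiPlusTwo_ne_zero (hζ : ζ ∈ scatDomain p) : psiPlusTwo p u t ζ ≠ 0 := fun h =>
  (hu.isJost_jostPlus hζ).ne_zero (by
    funext x i; fin_cases i <;> simp [jostPlus, reflectSol, h])

lemma continuous_ampShift : Continuous (ampShift p fun x => potential p u x t) :=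
  hu.isTail_minus.conts

lemma differentiableAt_jostMinus (hζ : 0 < ζ.im) (x : ℝ) :
    DifferentiableAt ℂ (fun ζ => jostMinus p u t ζ x) ζ :=
  (hu.isTail_minus.exists_local
    (fun _ h => hu.isJost_jostMinus (mem_scatDomain_of_im_pos p h)) hζ).1 x

lemma differentiableAt_jostPlus (hζ : 0 < ζ.im) (x : ℝ) :
    DifferentiableAt ℂ (fun ζ => jostPlus p u t ζ x) ζ :=
  (hu.isTail_plus.exists_local
    (fun _ h => hu.isJost_jostPlus (mem_scatDomain_of_im_pos p h)) hζ).1 x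

/-- The time factors of the two Jost solutions are mutually inverse and cancel in the Wronskian, so
they need not be differentiated. -/
lemma hasDerivAt_wronskian_psi (hζ : 0 < ζ.im) :
    HasDerivAt (fun ζ => wronskian (psiMinusOne p u t ζ 0) (psiPlusTwo p u t ζ 0))
      (deriv (fun ζ => jostMinus p u t ζ 0) ζ 0 * jostPlus p u t ζ 0 0 +
        jostMinus p u t ζ 0 0 * deriv (fun ζ => jostPlus p u t ζ 0) ζ 0 -
        (deriv (fun ζ => jostPlus p u t ζ 0) ζ 1 * jostMinus p u t ζ 0 1 +
        jostPlus p u t ζ 0 1 * deriv (fun ζ => jostMinus p u t ζ 0) ζ 1)) ζ := by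
  have hm := hasDerivAt_pi.1 (hu.differentiableAt_jostMinus hζ 0).hasDerivAt
  have hp := hasDerivAt_pi.1 (hu.differentiableAt_jostPlus hζ 0).hasDerivAt
  simp only [wronskian_psi_zero]
  exact ((hm 0).mul (hp 0)).sub ((hp 1).mul (hm 1))

lemma analyticOnNhd_scatA : AnalyticOnNhd ℂ (scatA p u t) {ζ | 0 < ζ.im} := by
  refine DifferentiableOn.analyticOnNhd (fun ζ hζ => ?_) isOpen_upper
  have hd := mem_scatDomain_of_im_pos p hζ
  have hz : ζ ^ 2 ≠ 0 := pow_ne_zero 2 hd.2.1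
  have h2 : DifferentiableAt ℂ (fun ζ : ℂ => 1 - (p.q₀ : ℂ) ^ 2 * (ζ ^ 2)⁻¹) ζ := by
    fun_prop (disch := assumption)
  exact ((hu.hasDerivAt_wronskian_psi hζ).differentiableAt.div h2
    (one_sub_ne_zero_of_mem hd)).differentiableWithinAt

lemma wronskian_psi_eq (hζ : ζ ∈ scatDomain p) (x : ℝ) :
    wronskian (psiMinusOne p u t ζ x) (psiPlusTwo p u t ζ x) =
      (1 - (p.q₀ : ℂ) ^ 2 * (ζ ^ 2)⁻¹) * scatA p u t ζ := by
  rw [scatA, mul_div_cancel₀ _ (one_sub_ne_zero_of_mem hζ)]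
  exact (hu.isZS_psiMinusOne hζ).wronskian_const (hu.isZS_psiPlusTwo hζ) x 0

lemma exists_smul_of_scatA_eq_zero (hζ : ζ ∈ scatDomain p) (ha : scatA p u t ζ = 0) :
    ∃ b : ℂ, b ≠ 0 ∧ ∀ x, psiMinusOne p u t ζ x = b • psiPlusTwo p u t ζ x := by
  obtain ⟨b, hb⟩ := (hu.isZS_psiMinusOne hζ).exists_smul_of_wronskian_eq_zero
    hu.continuous_potential hu.continuous_ampShift (hu.isZS_psiPlusTwo hζ) (x₀ := 0)
    (by rw [hu.wronskian_psi_eq hζ, ha, mul_zero]) (hu.psiPlusTwo_ne_zero hζ)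
  refine ⟨b, ?_, hb⟩
  rintro rfl
  exact hu.psiMinusOne_ne_zero hζ (by funext x; simp [hb x])

/-- The coefficient `a` has no real zeros. -/
lemma im_pos_of_scatA_eq_zero (hζ : ζ ∈ scatDomain p) {b : ℂ}
    (hb : ∀ x, psiMinusOne p u t ζ x = b • psiPlusTwo p u t ζ x) : 0 < ζ.im := by
  refine hζ.1.lt_of_ne fun him => ?_
  have him' : ζ.im = 0 := him.symm
  have e1 := (hu.isJost_jostMinus hζ).energy_eq hu.isTail_minus.norm_qm him' 0
  have e2 := (hu.isJost_jostPlus hζ).energy_eq hu.isTail_plus.norm_qm him' 0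
  have hc := timeFactor_ne_zero p t ζ
  simp only [jostMinus, hb, jostPlus, reflectSol, Pi.smul_apply, smul_eq_mul, norm_mul, norm_inv,
    neg_zero, cons_val_zero, cons_val_one] at e1 e2
  set d : ℝ := 1 - p.q₀ ^ 2 / ‖ζ‖ ^ 2 with hd
  set c : ℝ := ‖timeFactor p t ζ‖ with hcdef
  have hc0 : c ≠ 0 := norm_ne_zero_iff.2 hc
  have hcc : c * c⁻¹ = 1 := mul_inv_cancel₀ hc0
  -- Reflection exchanges the components, so d equals a nonnegative multiple of A² - B² by `e1` and
  -- a positive multiple of B² - A² by `e2`.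
  have h1 : d * (1 + (‖b‖ * c ^ 2) ^ 2) = 0 := by
    set A := ‖psiPlusTwo p u t ζ 0 0‖
    set B := ‖psiPlusTwo p u t ζ 0 1‖
    have e3 : c ^ 2 * d = B ^ 2 - A ^ 2 := by
      rw [← e2]; field_simp
    linear_combination -e1 + ‖b‖ ^ 2 * c ^ 2 * e3
  have h2 : d = 0 := (mul_eq_zero.1 h1).resolve_right (by positivity)
  have hζ0 : ‖ζ‖ ≠ 0 := norm_ne_zero_iff.2 hζ.2.1
  have h3 : p.q₀ ^ 2 = ζ.re ^ 2 := by
    have h4 : p.q₀ ^ 2 = ‖ζ‖ ^ 2 := by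
      rw [hd] at h2; field_simp at h2; linarith
    rw [h4, ← normSq_eq_norm_sq, normSq_apply, him']; ring
  have h5 : ζ = (ζ.re : ℂ) := Complex.ext (by simp) (by simp [him'])
  rcases sq_eq_sq_iff_eq_or_eq_neg.1 h3 with h | h
  · exact hζ.2.2.1 (by rw [h5, h])
  · exact hζ.2.2.2 (by rw [h5, h]; simp)

/-- Decay at +∞ is that of ψ₊₂ itself; decay at -∞ is inherited from ψ₋₁ after division by b. -/
lemma decay_of_scatA_eq_zero (hζ : 0 < ζ.im) {b : ℂ} (hb0 : b ≠ 0)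
    (hb : ∀ x, psiMinusOne p u t ζ x = b • psiPlusTwo p u t ζ x) :
    Integrable (fun x => ‖psiPlusTwo p u t ζ x‖ ^ 2) ∧
      Tendsto (psiPlusTwo p u t ζ) atBot (𝓝 0) ∧ Tendsto (psiPlusTwo p u t ζ) atTop (𝓝 0) := by
  have hd := mem_scatDomain_of_im_pos p hζ
  obtain ⟨C₁, c₁, hc₁, h₁⟩ := (hu.isTail_minus.exists_local
    (fun _ h => hu.isJost_jostMinus (mem_scatDomain_of_im_pos p h)) hζ).2
  obtain ⟨C₂, c₂, hc₂, h₂⟩ := (hu.isTail_plus.exists_local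
    (fun _ h => hu.isJost_jostPlus (mem_scatDomain_of_im_pos p h)) hζ).2
  have g₁ := h₁.self_of_nhds
  have g₂ := h₂.self_of_nhds
  have hc := timeFactor_ne_zero p t ζ
  have hn : 0 < ‖timeFactor p t ζ‖ := norm_pos_iff.2 hc
  have hbn : 0 < ‖b‖ := norm_pos_iff.2 hb0
  refine integrable_of_exp_decay (hu.isZS_psiPlusTwo hd).continuous hc₁ hc₂
    (C₁ := C₁ / (‖timeFactor p t ζ‖ * ‖b‖)) (C₂ := ‖timeFactor p t ζ‖ * C₂)
    (fun x hx => ?_) (fun x hx => ?_)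
  · have := g₁ x hx
    rw [jostMinus, hb, norm_smul, norm_smul] at this
    rw [div_mul_eq_mul_div, le_div_iff₀ (by positivity)]
    linarith
  · have h3 : ‖psiPlusTwo p u t ζ (-x)‖ ≤ ‖timeFactor p t ζ • jostPlus p u t ζ x‖ := by
      rw [jostPlus, smul_smul, mul_inv_cancel₀ hc, one_smul]
      refine (pi_norm_le_iff_of_nonneg (norm_nonneg _)).2 fun i => ?_
      fin_cases i
      · exact norm_le_pi_norm (reflectSol (psiPlusTwo p u t ζ) x) 1
      · exact norm_le_pi_norm (reflectSol (psiPlusTwo p u t ζ) x) 0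
    refine h3.trans ?_
    rw [norm_smul, mul_assoc]
    exact mul_le_mul_of_nonneg_left (g₂ x hx) hn.le

lemma norm_eq_of_scatA_eq_zero (hζ : 0 < ζ.im) {b : ℂ} (hb0 : b ≠ 0)
    (hb : ∀ x, psiMinusOne p u t ζ x = b • psiPlusTwo p u t ζ x) : ‖ζ‖ = p.q₀ := by
  have hd := mem_scatDomain_of_im_pos p hζ
  obtain ⟨h1, h2, h3⟩ := hu.decay_of_scatA_eq_zero hζ hb0 hb
  have h := (hu.isZS_psiPlusTwo hd).im_eq_zero (hu.psiPlusTwo_ne_zero hd) h1 h2 h3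
  rw [im_kappa, normSq_eq_norm_sq] at h
  have hζ0 : ‖ζ‖ ≠ 0 := norm_ne_zero_iff.2 hd.2.1
  have h4 : 1 - p.q₀ ^ 2 / ‖ζ‖ ^ 2 = 0 := by
    have : ζ.im * (1 - p.q₀ ^ 2 / ‖ζ‖ ^ 2) = 0 := by linarith
    exact (mul_eq_zero.1 this).resolve_left hζ.ne'
  field_simp at h4
  exact (pow_left_inj₀ (norm_nonneg _) p.q₀_pos.le two_ne_zero).1 (by linarith)

/-- The symmetry of `ψ₊₂` on the circle `|ζ| = q₀`. -/
lemma psiPlusTwo_symm (hζ : ζ ∈ scatDomain p) (hn : ‖ζ‖ = p.q₀) (x : ℝ) :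
    psiPlusTwo p u t ζ x 0 =
      -I * qInf p p.θp * ζ⁻¹ * (starRingEnd ℂ) (psiPlusTwo p u t ζ x 1) := by
  have h0 := hζ.2.1
  have hinv : (p.q₀ : ℂ) ^ 2 * ζ⁻¹ = (starRingEnd ℂ) ζ := by
    have : (p.q₀ : ℂ) ^ 2 = (starRingEnd ℂ) ζ * ζ := by
      rw [mul_comm, Complex.mul_conj, normSq_eq_norm_sq, hn]; push_cast; rfl
    rw [this, mul_assoc, mul_inv_cancel₀ h0, mul_one]
  -- On the circle iλ and z are real, hence so is the time factor, and it drops out of the symmetry.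
  have hc : (starRingEnd ℂ) (timeFactor p t ζ) = timeFactor p t ζ := by
    rw [timeFactor, ← Complex.exp_conj, lam, specZ, kappa, hinv]
    simp [Complex.conj_ofNat]
    ring_nf
  have hc0 := timeFactor_ne_zero p t ζ
  have h := (hu.isJost_jostPlus hζ).conj_symm hu.isTail_plus hζ hn (-x)
  simp only [jostPlus, reflectSol, Pi.smul_apply, smul_eq_mul, neg_neg, cons_val_zero,
    cons_val_one, map_mul, map_inv₀, hc, map_neg, conj_conj] at h
  field_simp at h ⊢
  linear_combination h

lemma hasDerivAt_scatA (hζ : 0 < ζ.im) (hn : ‖ζ‖ = p.q₀) (ha : scatA p u t ζ = 0) {b : ℂ}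
    (hb0 : b ≠ 0) (hb : ∀ x, psiMinusOne p u t ζ x = b • psiPlusTwo p u t ζ x) :
    HasDerivAt (scatA p u t)
      (-b * qInf p p.θp * ζ⁻¹ * ((∫ x, ‖psiPlusTwo p u t ζ x 1‖ ^ 2 : ℝ) : ℂ)) ζ := by
  have hd := mem_scatDomain_of_im_pos p hζ
  have hden := one_sub_ne_zero_of_mem hd
  have hc0 := timeFactor_ne_zero p t ζ
  have hw1 := hu.isTail_minus.wronskian_deriv
    (fun _ h => hu.isJost_jostMinus (mem_scatDomain_of_im_pos p h)) hζ
  have hw2 := hu.isTail_plus.wronskian_deriv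
    (fun _ h => hu.isJost_jostPlus (mem_scatDomain_of_im_pos p h)) hζ
  set c := timeFactor p t ζ with hc
  set ψ := psiPlusTwo p u t ζ with hψ
  have hM : ∀ x i, jostMinus p u t ζ x i = c * (b * ψ x i) := fun x i => by
    simp [jostMinus, hb, hc, hψ]
  have hP0 : ∀ x, jostPlus p u t ζ x 0 = c⁻¹ * ψ (-x) 1 := fun x => by
    simp [jostPlus, reflectSol, hc, hψ]
  have hP1 : ∀ x, jostPlus p u t ζ x 1 = c⁻¹ * ψ (-x) 0 := fun x => by
    simp [jostPlus, reflectSol, hc, hψ]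
  have hI1 : ∫ x in Iic 0, jostMinus p u t ζ x 0 * jostMinus p u t ζ x 1 =
      (c * b) ^ 2 * ∫ x in Iic 0, ψ x 0 * ψ x 1 := by
    rw [← integral_const_mul]
    refine integral_congr_ae (ae_of_all _ fun x => ?_)
    simp only [hM]; ring
  have hI2 : ∫ x in Iic 0, jostPlus p u t ζ x 0 * jostPlus p u t ζ x 1 =
      (c⁻¹) ^ 2 * ∫ x in Ioi 0, ψ x 0 * ψ x 1 := by
    have h := integral_comp_neg_Iic 0 fun x => ψ x 0 * ψ x 1
    rw [neg_zero] at h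
    rw [← h, ← integral_const_mul]
    refine integral_congr_ae (ae_of_all _ fun x => ?_)
    simp only [hP0, hP1]; ring
  have hmod : ∀ x, ψ x 0 * ψ x 1 = -I * qInf p p.θp * ζ⁻¹ * ((‖ψ x 1‖ ^ 2 : ℝ) : ℂ) := fun x => by
    rw [hψ, hu.psiPlusTwo_symm hd hn x, ← normSq_eq_norm_sq, ← Complex.mul_conj]
    ring
  have hint : Integrable fun x => ψ x 0 * ψ x 1 := by
    have hψc : Continuous ψ := (hu.isZS_psiPlusTwo hd).continuous
    refine (hu.decay_of_scatA_eq_zero hζ hb0 hb).1.mono' (by fun_prop) (ae_of_all _ fun x => ?_)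
    rw [norm_mul, sq]
    exact mul_le_mul (norm_le_pi_norm _ _) (norm_le_pi_norm _ _) (norm_nonneg _) (norm_nonneg _)
  have hsum : (∫ x in Iic 0, ψ x 0 * ψ x 1) + ∫ x in Ioi 0, ψ x 0 * ψ x 1 =
      -I * qInf p p.θp * ζ⁻¹ * ((∫ x, ‖ψ x 1‖ ^ 2 : ℝ) : ℂ) := by
    rw [← setIntegral_union (Iic_disjoint_Ioi le_rfl) measurableSet_Ioi hint.integrableOn
      hint.integrableOn, Iic_union_Ioi, setIntegral_univ]
    simp only [hmod]
    rw [integral_const_mul, integral_complex_ofReal]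
  have hW0 : wronskian (psiMinusOne p u t ζ 0) (psiPlusTwo p u t ζ 0) = 0 := by
    rw [hu.wronskian_psi_eq hd, ha, mul_zero]
  have h1 : HasDerivAt (fun ζ : ℂ => 1 - (p.q₀ : ℂ) ^ 2 * (ζ ^ 2)⁻¹)
      (deriv (fun ζ : ℂ => 1 - (p.q₀ : ℂ) ^ 2 * (ζ ^ 2)⁻¹) ζ) ζ := by
    have hz : ζ ^ 2 ≠ 0 := pow_ne_zero 2 hd.2.1
    have h2 : DifferentiableAt ℂ (fun ζ : ℂ => 1 - (p.q₀ : ℂ) ^ 2 * (ζ ^ 2)⁻¹) ζ := by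
      fun_prop (disch := assumption)
    exact h2.hasDerivAt
  refine ((hu.hasDerivAt_wronskian_psi hζ).div h1 hden).congr_deriv ?_
  -- At a zero of the Wronskian the quotient rule leaves only the derivative of the numerator; the
  -- factor 1 - q₀²/ζ² that it then carries cancels the denominator.
  rw [hW0, zero_mul, sub_zero, sq (1 - (p.q₀ : ℂ) ^ 2 * (ζ ^ 2)⁻¹), mul_div_mul_right _ _ hden, div_eq_iff hden]
  rw [hI1] at hw1
  rw [hI2] at hw2
  simp only [wronskian, hM, hP0, hP1, neg_zero] at hw1 hw2 ⊢
  generalize (∫ x in Iic 0, ψ x 0 * ψ x 1) = A at *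
  generalize (∫ x in Ioi 0, ψ x 0 * ψ x 1) = B at *
  generalize deriv (fun ζ => jostMinus p u t ζ 0) ζ = DM at *
  generalize deriv (fun ζ => jostPlus p u t ζ 0) ζ = DP at *
  generalize ((∫ x, ‖ψ x 1‖ ^ 2 : ℝ) : ℂ) = N at *
  generalize ψ 0 0 = x at *
  generalize ψ 0 1 = y at *
  generalize 1 - (p.q₀ : ℂ) ^ 2 * (ζ ^ 2)⁻¹ = d at *
  -- Since ψ₋₁ = bψ₊₂, the two halves of the product rule are multiples of the self-Wronskians in
  -- `hw1` and `hw2`. After the scalars cancel, they contribute -i d b A and -i d b B.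
  have k1 : c * b * (DM 0 * y - DM 1 * x) = -(I * d) * ((c * b) ^ 2 * A) := by
    linear_combination hw1
  have k2 : c⁻¹ * (DP 0 * x - DP 1 * y) = -(I * d) * (c⁻¹ ^ 2 * B) := by
    linear_combination hw2
  have k3 : DM 0 * y - DM 1 * x = -(I * d) * (c * b * A) :=
    mul_left_cancel₀ (mul_ne_zero hc0 hb0) (by linear_combination k1)
  have k4 : DP 0 * x - DP 1 * y = -(I * d) * (c⁻¹ * B) :=
    mul_left_cancel₀ (inv_ne_zero hc0) (by linear_combination k2)
  have hcc : c * c⁻¹ = 1 := mul_inv_cancel₀ hc0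
  linear_combination c⁻¹ * k3 + c * b * k4 - I * d * b * (A + B) * hcc - I * d * b * hsum +
    b * qInf p p.θp * ζ⁻¹ * N * d * I_mul_I

lemma integrable_psiPlusTwo (hζ : 0 < ζ.im) {b : ℂ} (hb0 : b ≠ 0)
    (hb : ∀ x, psiMinusOne p u t ζ x = b • psiPlusTwo p u t ζ x) :
    Integrable fun x => ‖psiPlusTwo p u t ζ x 1‖ ^ 2 := by
  have hc := (hu.isZS_psiPlusTwo (mem_scatDomain_of_im_pos p hζ)).continuous
  refine (hu.decay_of_scatA_eq_zero hζ hb0 hb).1.mono' (by fun_prop) (ae_of_all _ fun x => ?_)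
  rw [norm_pow, norm_norm]
  exact pow_le_pow_left₀ (norm_nonneg _) (norm_le_pi_norm _ _) 2

/-- If the second component vanished identically, the symmetry on the circle would kill the first
one too, contradicting ψ₊₂ ≠ 0. -/
lemma integral_psiPlusTwo_ne_zero (hζ : 0 < ζ.im) (hn : ‖ζ‖ = p.q₀)
    (hi : Integrable fun x => ‖psiPlusTwo p u t ζ x 1‖ ^ 2) :
    (∫ x, ‖psiPlusTwo p u t ζ x 1‖ ^ 2) ≠ 0 := by
  have hd := mem_scatDomain_of_im_pos p hζ
  have hc := (hu.isZS_psiPlusTwo hd).continuous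
  intro h
  rw [integral_eq_zero_iff_of_nonneg (fun x => by positivity) hi] at h
  replace h := (Continuous.ae_eq_iff_eq volume (by fun_prop) continuous_zero).1 h
  refine hu.psiPlusTwo_ne_zero hd (funext fun x => ?_)
  have h1 : psiPlusTwo p u t ζ x 1 = 0 := by simpa using congrFun h x
  have h0 := hu.psiPlusTwo_symm hd hn x
  rw [h1, map_zero, mul_zero] at h0
  ext i
  fin_cases i
  · exact h0
  · exact h1

end NonzeroBoundary

end Zeros

end KE

theorem mainTheorem2 (p : KE.Params) (u : ℝ → ℝ → ℂ) (t : ℝ) (hu : KE.NonzeroBoundary p u t) :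
    -- the Jost solutions, and with them `a`, are well defined
    (∀ ζ ∈ KE.scatDomain p,
      (∃! f, KE.IsJostMinusOne p u t ζ f) ∧ (∃! f, KE.IsJostPlusTwo p u t ζ f) ∧
      ∀ x, KE.wronskian (KE.psiMinusOne p u t ζ x) (KE.psiPlusTwo p u t ζ x)
        = (1 - (p.q₀ : ℂ) ^ 2 * (ζ ^ 2)⁻¹) * KE.scatA p u t ζ) ∧
    -- `a` is analytic in the upper half plane
    AnalyticOnNhd ℂ (KE.scatA p u t) {ζ | 0 < ζ.im} ∧
    -- every zero lies on the open upper semicircle and is simple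
    (∀ ζ ∈ KE.scatDomain p, KE.scatA p u t ζ = 0 →
      0 < ζ.im ∧ ‖ζ‖ = p.q₀ ∧
      ∃ b : ℂ, (∀ x, KE.psiMinusOne p u t ζ x = b • KE.psiPlusTwo p u t ζ x) ∧
        Integrable (fun x => ‖KE.psiPlusTwo p u t ζ x 1‖ ^ 2) ∧
        HasDerivAt (KE.scatA p u t)
          (-b * KE.qInf p p.θp * ζ⁻¹ * ((∫ x, ‖KE.psiPlusTwo p u t ζ x 1‖ ^ 2 : ℝ) : ℂ)) ζ ∧
        -b * KE.qInf p p.θp * ζ⁻¹ * ((∫ x, ‖KE.psiPlusTwo p u t ζ x 1‖ ^ 2 : ℝ) : ℂ) ≠ 0) := by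
  refine ⟨fun ζ hζ => ⟨hu.existsUnique_jostMinusOne hζ, hu.existsUnique_jostPlusTwo hζ,
    hu.wronskian_psi_eq hζ⟩, hu.analyticOnNhd_scatA, fun ζ hζ ha => ?_⟩
  obtain ⟨b, hb0, hb⟩ := hu.exists_smul_of_scatA_eq_zero hζ ha
  have him := hu.im_pos_of_scatA_eq_zero hζ hb
  have hn := hu.norm_eq_of_scatA_eq_zero him hb0 hb
  have hi := hu.integrable_psiPlusTwo him hb0 hb
  refine ⟨him, hn, b, hb, hi, hu.hasDerivAt_scatA him hn ha hb0 hb, ?_⟩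
  have hq : KE.qInf p p.θp ≠ 0 := norm_ne_zero_iff.1 (by rw [KE.norm_qInf]; exact p.q₀_pos.ne')
  exact mul_ne_zero (mul_ne_zero (mul_ne_zero (neg_ne_zero.2 hb0) hq) (inv_ne_zero hζ.2.1))
    (ofReal_ne_zero.2 (hu.integral_psiPlusTwo_ne_zero him hn hi))
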